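/- **Notation.** All identities are identities of formal expressions in fractional powers of $q$. Put $(q)_n=\prod_{k=1}^n(1-q^k)$, and let $\left[{a\atop b}\right]=\frac{(q)_a}{(q)_b(q)_{a-b}}$ if $b$ and $a-b$ are nonnegative integers, and $\left[{a\atop b}\right]=0$ otherwise. For $N\ge 1$ let $C$ be the Cartan matrix of $A_{N-1}$, $\mathcal I=2I-C$, and let $e_1,\dots,e_{N-1}$ be the standard unit vectors of $\mathbb Z^{N-1}$. For $m,n\in\mathbb Z^{N-1}$ put $\left[{m+n\atop n}\right]=\prod_{k=1}^{N-1}\left[{m_k+n_k\atop n_k}\right]$. Write $M_{12}=M_1-M_2$ and $L_{12}=L_1-L_2$. Define $$X^{(p,p')}_{r,s}(M_1,L_1,M_2,L_2)=\sum_{j\in\mathbb Z}\Big\{q^{j(pp'j+p'(M_{12}+r)-ps)}\left[{M_1+L_1-(p'-p)j\atop M_1+pj}\right]\left[{M_2+L_2+(p'-p)j\atop M_2-pj}\right]-q^{(pj+M_{12}+r)(p'j+s)}\left[{M_1+L_1-(p'-p)j+r-s\atop M_1+pj+r}\right]\left[{M_2+L_2+(p'-p)j-r+s\atop M_2-pj-r}\right]\Big\}.$$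 For $t,a,b,u,v$ let $$S_N(t;a,b;u,v)=\sum_{\eta}q^{\eta C^{-1}\eta}\left[{\mu+\eta\atop \eta}\right]\left[{u-\frac12(b-\mu_1)\atop a}\right]\left[{v-\frac12(a-\mu_{N-1})\atop b}\right],$$ the sum being over $\eta\in\mathbb Z^{N-1}$ with $t+(C^{-1}\eta)_1\in\mathbb Z$, where $\mu\in\mathbb Z^{N-1}$ is determined by $\mu+\eta=\frac12(\mathcal I\mu+a e_1+b e_{N-1})$ (for $N=1$ one interprets $\mu_1=b$, $\mu_0=a$, $(C^{-1}\eta)_1=0$). For $\sigma\in\{0,1\}$ define $$X^{(p,p'),N}_{r,s,\sigma}(M_1,L_1,M_2,L_2)=\sum_{j\in\mathbb Z}\Big\{q^{\frac jN(pp'j+p'(M_{12}+r)-ps)}\,S_N\big(\tfrac{M_{12}+2pj+\sigma N}{2N};\,M_1+pj,\,M_2-pj;\,M_1+L_1-\tfrac{(p'-p)j}{N},\,M_2+L_2+\tfrac{(p'-p)j}{N}\big)$$ $$-\,q^{\frac1N(pj+M_{12}+r)(p'j+s)}\,S_N\big(\tfrac{M_{12}+2pj+2r+\sigma N}{2N};\,M_1+pj+r,\,M_2-pj-r;\,M_1+L_1-\tfrac{(p'-p)j-r+s}{N},\,M_2+L_2+\tfrac{(p'-p)j-r+s}{N}\big)\Big\}.$$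 **Theorem.** Let $N\ge1$, $\sigma\in\{0,1\}$, and let $p,p'$ be integers with $1\le p<p'$. Below, $m\in\mathbb Z^{N-1}$ is determined by $n\in\mathbb Z^{N-1}$ through $m+n=\frac12(\mathcal I m+(2i+M_{12})e_1)$ (for $N=1$: $m_1=0$ and $(C^{-1}n)_1=0$). (1) Let $r,s,M_1,M_2$ be integers with $M_{12}+\sigma N$ even, and let $L_1,L_2$ be such that $L_1+\frac{M_{12}+\sigma}2$ and $L_2+\frac{M_{12}+\sigma}2$ are integers. Assume that $$\left\lfloor\frac{L_2-M_{12}\frac{N-1}{2N}-r-\frac sN}{p+p'/N}\right\rfloor\le\left\lfloor\frac{L_1+M_{12}+r-s}{p'-p}\right\rfloor,\qquad \left\lfloor\frac{L_1+M_{12}\frac{N-1}{2N}+r+\frac sN}{p+p'/N}\right\rfloor\le\left\lfloor\frac{L_2-M_{12}-r+s}{p'-p}\right\rfloor,$$ and that the two inequalities obtained from these by setting $r=s=0$ hold as well. Then all sums below have only finitely many nonzero terms, and $$X^{(p',Np+p'),N}_{s-M_{12},\,N(r+L_{12}+M_{12})+s-M_{12},\,\sigma}(M_1,L_1,M_2,L_2)=\sum_{i\in\mathbb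 Z}q^{i(i+M_{12})/N}\left[{L_1+L_2+M_2-i\atop M_2-i}\right]\sum_{n}q^{nC^{-1}n}\left[{m+n\atop n}\right]X^{(p,p')}_{r,s}\big(L_1-i+\tfrac12m_1,\;i+M_{12},\;L_2-M_{12}-i+\tfrac12m_1,\;i\big),$$ where $n$ runs over the vectors in $\mathbb Z^{N-1}$ with $\frac{2i+M_{12}+\sigma N}{2N}+(C^{-1}n)_1\in\mathbb Z$. (2) (Symmetric case $M_1=M_2=M$, $L_1=L_2=L$.) Let $M,r,s$ be integers with $0\le r\le p$ and $0\le s\le p'$, let $\sigma N$ be even and $L+\frac\sigma2$ an integer. Assume that $$\left\lfloor\frac{L+s+r/N}{p'+p/N}\right\rfloor\le\left\lfloor\frac{L-r+s}{p'-p}\right\rfloor.$$ Then all sums below have only finitely many nonzero terms, and $$X^{(p',Np+p'),N}_{s,\,Nr+s,\,\sigma}(M,L,M,L)=\sum_{i=0}^{M}q^{i^2/N}\left[{2L+M-i\atop 2L}\right]\sum_{n}q^{nC^{-1}n}\left[{m+n\atop n}\right]X^{(p,p')}_{r,s}\big(L-i+\tfrac12m_1,\;i,\;L-i+\tfrac12m_1,\;i\big),$$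 where $n$ runs over the vectors in $\mathbb Z^{N-1}$ with $\frac{2i+\sigma N}{2N}+(C^{-1}n)_1\in\mathbb Z$. -/

import Mathlib

/-- The field of Hahn series in the formal variable `q` with rational exponents and rational
coefficients. All identities are identities of formal expressions in (fractional powers of) `q`. -/
abbrev QSeries : Type := HahnSeries ℚ ℚ

namespace BurgeTransform

/-- The formal power `q ^ e`, for a rational exponent `e`. -/
noncomputable def qpow (e : ℚ) : QSeries := HahnSeries.single e (1 : ℚ)

/-- The `q`-shifted factorial `(q)_n = ∏_{k=1}^n (1 - q^k)`, for `n ≥ 0`. -/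
noncomputable def qfac (n : ℕ) : QSeries :=
  ∏ k ∈ Finset.range n, (1 - qpow ((k : ℚ) + 1))

open scoped Classical in
/-- The `q`-binomial coefficient with top entry `a` and bottom entry `b`. With `b = k` and
`a = k + l` it is `(q)_{k+l} / ((q)_k (q)_l)` if `k, l` are nonnegative integers, and it is `0`
otherwise. (The entries are typed as rationals because they are built from half-integers; in all
the expressions below they are integers.) -/
noncomputable def qbin (a b : ℚ) : QSeries :=
  if ∃ k l : ℕ, b = k ∧ a - b = l then qfac ⌊a⌋₊ / (qfac ⌊b⌋₊ * qfac ⌊a - b⌋₊) else 0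

/-- The Cartan matrix `C` of `A_{N-1}`, with rational entries. -/
def cartan (N : ℕ) : Matrix (Fin (N - 1)) (Fin (N - 1)) ℚ :=
  (CartanMatrix.A (N - 1)).map (fun x : ℤ => (x : ℚ))

/-- The incidence matrix `𝓘 = 2 I - C` of `A_{N-1}`. -/
def incidence (N : ℕ) : Matrix (Fin (N - 1)) (Fin (N - 1)) ℚ :=
  (2 : ℚ) • (1 : Matrix (Fin (N - 1)) (Fin (N - 1)) ℚ) - cartan N

/-- An integer vector, seen as a rational vector. -/
def toRat {N : ℕ} (n : Fin (N - 1) → ℤ) : Fin (N - 1) → ℚ := fun k => (n k : ℚ)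

/-- The unit vector `e_1` (there is none for `N = 1`). -/
def eFirst (N : ℕ) : Fin (N - 1) → ℚ := fun k => if k.val = 0 then 1 else 0

/-- The unit vector `e_{N-1}` (there is none for `N = 1`). -/
def eLast (N : ℕ) : Fin (N - 1) → ℚ := fun k => if k.val + 1 = N - 1 then 1 else 0

/-- The first component `v_1` of a vector `v`; for `N = 1` it is interpreted as `d`. -/
def firstComp {N : ℕ} (v : Fin (N - 1) → ℚ) (d : ℚ) : ℚ :=
  if h : 0 < N - 1 then v ⟨0, h⟩ else d

/-- The last component `v_{N-1}` of a vector `v`; for `N = 1` it is interpreted as `d`. -/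
def lastComp {N : ℕ} (v : Fin (N - 1) → ℚ) (d : ℚ) : ℚ :=
  if h : 0 < N - 1 then v ⟨N - 1 - 1, Nat.sub_lt h Nat.one_pos⟩ else d

/-- `C⁻¹ n`. -/
noncomputable def cinvMul {N : ℕ} (n : Fin (N - 1) → ℤ) : Fin (N - 1) → ℚ :=
  Matrix.mulVec (cartan N)⁻¹ (toRat n)

/-- The pairs `(m, n)` of integer vectors that solve the system
`m + n = (𝓘 m + a e_1 + b e_{N-1}) / 2` and obey the restriction `t + (C⁻¹ n)_1 ∈ ℤ`. The vector
`m` is determined by `n`, so that a sum over these pairs is a sum over `n`. For `N = 1` the only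
vector is the empty one, and the term `(C⁻¹ n)_1` is absent. -/
def mnPairs (N : ℕ) (t a b : ℚ) : Set ((Fin (N - 1) → ℤ) × (Fin (N - 1) → ℤ)) :=
  {x | toRat x.1 + toRat x.2
        = (1 / 2 : ℚ) • (Matrix.mulVec (incidence N) (toRat x.1) + a • eFirst N + b • eLast N) ∧
      ∃ z : ℤ, t + firstComp (cinvMul x.2) 0 = z}

/-- `q^{n C⁻¹ n} ∏_j [m_j + n_j ; n_j]` for a pair `x = (m, n)`. -/
noncomputable def weight {N : ℕ} (x : (Fin (N - 1) → ℤ) × (Fin (N - 1) → ℤ)) : QSeries :=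
  qpow (dotProduct (toRat x.2) (cinvMul x.2)) *
    ∏ k : Fin (N - 1), qbin ((x.1 k : ℚ) + (x.2 k : ℚ)) (x.2 k : ℚ)

/-! ### Burge's polynomial `X_{r,s}^{(p,p')}(M₁,L₁,M₂,L₂)` -/

/-- The summand, for given `j`, of Burge's polynomial. -/
noncomputable def XTerm (p p' r s M₁ L₁ M₂ L₂ : ℚ) (j : ℤ) : QSeries :=
  qpow (j * (p * p' * j + p' * (M₁ - M₂ + r) - p * s)) *
      qbin (M₁ + L₁ - (p' - p) * j) (M₁ + p * j) * qbin (M₂ + L₂ + (p' - p) * j) (M₂ - p * j)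
    - qpow ((p * j + (M₁ - M₂) + r) * (p' * j + s)) *
      qbin (M₁ + L₁ - (p' - p) * j + r - s) (M₁ + p * j + r) *
      qbin (M₂ + L₂ + (p' - p) * j - r + s) (M₂ - p * j - r)

/-- Burge's polynomial `X_{r,s}^{(p,p')}(M₁,L₁,M₂,L₂)`. -/
noncomputable def X (p p' r s M₁ L₁ M₂ L₂ : ℚ) : QSeries :=
  ∑ᶠ j : ℤ, XTerm p p' r s M₁ L₁ M₂ L₂ j

/-! ### The level-`N` polynomial `X_{r,s,σ}^{(p,p'),N}(M₁,L₁,M₂,L₂)` -/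

/-- The summand, for a solution `x = (μ, η)` of the system with parameters `a, b`, of the inner sum
of the level-`N` polynomial:
`q^{η C⁻¹ η} [μ+η ; η] [u - (b - μ_1)/2 ; a] [v - (a - μ_{N-1})/2 ; b]`.
For `N = 1` one interprets `μ_1 = b` and `μ_0 = a`. -/
noncomputable def innerTerm {N : ℕ} (a b u v : ℚ)
    (x : (Fin (N - 1) → ℤ) × (Fin (N - 1) → ℤ)) : QSeries :=
  weight x * qbin (u - (b - firstComp (toRat x.1) b) / 2) a *
    qbin (v - (a - lastComp (toRat x.1) a) / 2) b

/-- The inner sum, over `η`, of the level-`N` polynomial. -/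
noncomputable def innerSum (N : ℕ) (t a b u v : ℚ) : QSeries :=
  ∑ᶠ x ∈ mnPairs N t a b, innerTerm a b u v x

/-- The summand, for given `j`, of the level-`N` polynomial. -/
noncomputable def XNTerm (N σ : ℕ) (p p' r s M₁ L₁ M₂ L₂ : ℚ) (j : ℤ) : QSeries :=
  qpow (j / N * (p * p' * j + p' * (M₁ - M₂ + r) - p * s)) *
      innerSum N ((M₁ - M₂ + 2 * p * j + σ * N) / (2 * N)) (M₁ + p * j) (M₂ - p * j)
        (M₁ + L₁ - (p' - p) * j / N) (M₂ + L₂ + (p' - p) * j / N)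
    - qpow (1 / N * (p * j + (M₁ - M₂) + r) * (p' * j + s)) *
      innerSum N ((M₁ - M₂ + 2 * p * j + 2 * r + σ * N) / (2 * N))
        (M₁ + p * j + r) (M₂ - p * j - r)
        (M₁ + L₁ - ((p' - p) * j - r + s) / N) (M₂ + L₂ + ((p' - p) * j - r + s) / N)

/-- The level-`N` polynomial `X_{r,s,σ}^{(p,p'),N}(M₁,L₁,M₂,L₂)`. -/
noncomputable def XN (N σ : ℕ) (p p' r s M₁ L₁ M₂ L₂ : ℚ) : QSeries :=
  ∑ᶠ j : ℤ, XNTerm N σ p p' r s M₁ L₁ M₂ L₂ j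

/-! ### The right-hand side of the dual transform -/

/-- The summand, for given `i` and given `x = (m, n)`, of the inner sum of the dual transform:
`q^{n C⁻¹ n} [m+n ; n] X_{r,s}^{(p,p')}(L₁ - i + m_1/2, i + M₁₂, L₂ - M₁₂ - i + m_1/2, i)`, with
`M₁₂` written `M12`. For `N = 1` one has `m_1 = 0`. -/
noncomputable def dualInnerTerm {N : ℕ} (p p' r s M12 L₁ L₂ : ℚ) (i : ℤ)
    (x : (Fin (N - 1) → ℤ) × (Fin (N - 1) → ℤ)) : QSeries :=
  weight x * X p p' r s (L₁ - i + firstComp (toRat x.1) 0 / 2) (i + M12)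
    (L₂ - M12 - i + firstComp (toRat x.1) 0 / 2) i

/-- The inner sum, over `n`, of the dual transform. -/
noncomputable def dualInner (N σ : ℕ) (p p' r s M12 L₁ L₂ : ℚ) (i : ℤ) : QSeries :=
  ∑ᶠ x ∈ mnPairs N ((2 * i + M12 + σ * N) / (2 * N)) (2 * i + M12) 0,
    dualInnerTerm p p' r s M12 L₁ L₂ i x

/-- The summand, for given `i`, of the dual transform. -/
noncomputable def dualTerm (N σ : ℕ) (p p' r s M₁ L₁ M₂ L₂ : ℚ) (i : ℤ) : QSeries :=
  qpow (i * (i + (M₁ - M₂)) / N) * qbin (L₁ + L₂ + M₂ - i) (M₂ - i) *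
    dualInner N σ p p' r s (M₁ - M₂) L₁ L₂ i

/-- The two floor inequalities that make up the sufficiency condition of the dual transform, for
given `r` and `s`. -/
def Sufficient (N : ℕ) (p p' r s M₁ L₁ M₂ L₂ : ℚ) : Prop :=
  ⌊(L₂ - (M₁ - M₂) * (N - 1) / (2 * N) - r - s / N) / (p + p' / N)⌋
      ≤ ⌊(L₁ + (M₁ - M₂) + r - s) / (p' - p)⌋ ∧
  ⌊(L₁ + (M₁ - M₂) * (N - 1) / (2 * N) + r + s / N) / (p + p' / N)⌋
      ≤ ⌊(L₂ - (M₁ - M₂) - r + s) / (p' - p)⌋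

/-- All the sums in the level-`N` polynomial have only finitely many nonzero terms. -/
def XNFinite (N σ : ℕ) (p p' r s M₁ L₁ M₂ L₂ : ℚ) : Prop :=
  (Function.support (XNTerm N σ p p' r s M₁ L₁ M₂ L₂)).Finite ∧
  ∀ j : ℤ,
    (mnPairs N ((M₁ - M₂ + 2 * p * j + σ * N) / (2 * N)) (M₁ + p * j) (M₂ - p * j) ∩
      Function.support (innerTerm (M₁ + p * j) (M₂ - p * j)
        (M₁ + L₁ - (p' - p) * j / N) (M₂ + L₂ + (p' - p) * j / N))).Finite ∧
    (mnPairs N ((M₁ - M₂ + 2 * p * j + 2 * r + σ * N) / (2 * N))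
        (M₁ + p * j + r) (M₂ - p * j - r) ∩
      Function.support (innerTerm (M₁ + p * j + r) (M₂ - p * j - r)
        (M₁ + L₁ - ((p' - p) * j - r + s) / N)
        (M₂ + L₂ + ((p' - p) * j - r + s) / N))).Finite

/-- All the sums in the right-hand side of the dual transform, including those that define the
polynomials `X_{r,s}^{(p,p')}` in it, have only finitely many nonzero terms. -/
def DualFinite (N σ : ℕ) (p p' r s M₁ L₁ M₂ L₂ : ℚ) : Prop :=
  (Function.support (dualTerm N σ p p' r s M₁ L₁ M₂ L₂)).Finite ∧
  ∀ i : ℤ,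
    (mnPairs N ((2 * i + (M₁ - M₂) + σ * N) / (2 * N)) (2 * i + (M₁ - M₂)) 0 ∩
      Function.support (dualInnerTerm p p' r s (M₁ - M₂) L₁ L₂ i)).Finite ∧
    ∀ x ∈ mnPairs N ((2 * i + (M₁ - M₂) + σ * N) / (2 * N)) (2 * i + (M₁ - M₂)) 0,
      (Function.support (XTerm p p' r s (L₁ - i + firstComp (toRat x.1) 0 / 2) (i + (M₁ - M₂))
        (L₂ - (M₁ - M₂) - i + firstComp (toRat x.1) 0 / 2) i)).Finite

end BurgeTransform

namespace BurgeTransform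

/-! Everything rests on one summation formula. Put n = N - 1 and write a solution of the (m,
n)-system as a chain a, m_1, …, m_n, b. Then C⁻¹η is half the gap between the chord through the end
points and the chain. Hence q^{ηC⁻¹η} is the product of q^{(x-y)²/4} over the edges (x, y) of the
chain, times the chord factor q^{-(a-b)²/(4N)}. The restriction on (C⁻¹η)_1 fixes the parity of
every edge, and m_k + η_k is the mean of the two neighbours of m_k. So the inner sum of the level-N
polynomial is a sum over chains from K to M with two further q-binomials. It equals a sum over j of
chains from K + M - 2j to 0 (`innerSum_eq_dual`); for N = 1 this is the q-Saalschütz sum.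

For Gaussian polynomials `gauss` with arbitrary top entry the formula needs no sign condition on the
parameters A, B (`chainSum_eq_dualChainSum`). The proof removes one vertex at a time: the induction
hypothesis dualizes the rest of the chain, and `gauss_exchange`, which is q-Saalschütz used twice,
absorbs the removed vertex. The truncated `qbin` agrees with `gauss` when the top entry is a
nonnegative integer; `Admissible` is what makes the products agree in the remaining cases. It
follows from the floor inequalities (`admissible_of_sufficient`) or from the ranges of r and s in
the symmetric case (`admissible_symmetric`).

Applied to both parts of each summand of the level-N polynomial, with i equal to M₂ minus the new
summation variable, the formula produces the products of q-binomials in Burge's polynomial.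
Interchanging the finite sums over i and j gives the transform (`XN_eq_finsum_dualTerm`). -/

lemma qpow_zero : qpow 0 = 1 := rfl

lemma qpow_add (a b : ℚ) : qpow (a + b) = qpow a * qpow b := by
  simp [qpow, HahnSeries.single_mul_single]

lemma qpow_ne_zero (a : ℚ) : qpow a ≠ 0 := by
  simp [qpow]

lemma qpow_injective : Function.Injective qpow := by
  intro a b h
  by_contra hab
  have := congrArg (fun f : QSeries => f.coeff a) h
  simp [qpow, hab] at this

lemma one_sub_qpow_ne_zero {a : ℚ} (ha : a ≠ 0) : 1 - qpow a ≠ 0 := by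
  rw [← qpow_zero, sub_ne_zero]
  exact fun h => ha (qpow_injective h).symm

lemma qfac_zero : qfac 0 = 1 := by simp [qfac]

lemma qfac_succ (n : ℕ) : qfac (n + 1) = qfac n * (1 - qpow ((n : ℚ) + 1)) := by
  simp [qfac, Finset.prod_range_succ]

lemma qfac_ne_zero (n : ℕ) : qfac n ≠ 0 := by
  refine Finset.prod_ne_zero_iff.2 fun k _ => one_sub_qpow_ne_zero ?_
  positivity

/-! ### Gaussian polynomials with arbitrary top entry: q-Vandermonde and q-Saalschütz -/

/-- The Gaussian polynomial with arbitrary top entry and natural bottom entry. -/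
noncomputable def gaussNat (x : ℚ) (n : ℕ) : QSeries :=
  (∏ i ∈ Finset.range n, (1 - qpow (x - i))) / qfac n

/-- The Gaussian polynomial with arbitrary top entry and integer bottom entry; it vanishes when
the bottom entry is negative. -/
noncomputable def gauss (x : ℚ) (b : ℤ) : QSeries :=
  if 0 ≤ b then gaussNat x b.toNat else 0

lemma gaussNat_zero (x : ℚ) : gaussNat x 0 = 1 := by simp [gaussNat, qfac_zero]

lemma one_sub_mul_gaussNat_succ (x : ℚ) (n : ℕ) :
    (1 - qpow ((n : ℚ) + 1)) * gaussNat x (n + 1) = (1 - qpow (x - n)) * gaussNat x n := by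
  have h1 := qfac_ne_zero n
  have h2 : 1 - qpow ((n : ℚ) + 1) ≠ 0 := one_sub_qpow_ne_zero (by positivity)
  rw [gaussNat, gaussNat, Finset.prod_range_succ, qfac_succ]
  field_simp

lemma gauss_natCast (x : ℚ) (n : ℕ) : gauss x n = gaussNat x n := by simp [gauss]

lemma gauss_of_neg (x : ℚ) {b : ℤ} (hb : b < 0) : gauss x b = 0 := by
  simp [gauss, not_le.2 hb]

lemma gauss_ne_zero_bot {x : ℚ} {b : ℤ} (h : gauss x b ≠ 0) : 0 ≤ b := by
  by_contra hb
  exact h (gauss_of_neg x (not_le.1 hb))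

/-- The `q`-Vandermonde sum. -/
lemma gaussNat_vandermonde (x y : ℚ) (n : ℕ) :
    ∑ i ∈ Finset.range (n + 1), qpow ((x - i) * (n - i)) * gaussNat x i * gaussNat y (n - i)
      = gaussNat (x + y) n := by
  induction n with
  | zero => simp [gaussNat_zero, qpow_zero]
  | succ n ih =>
    have h2 : 1 - qpow ((n : ℚ) + 1) ≠ 0 := one_sub_qpow_ne_zero (by positivity)
    apply mul_left_cancel₀ h2
    rw [one_sub_mul_gaussNat_succ, ← ih, Finset.mul_sum, Finset.mul_sum]
    -- Uses 1 - q^{n+1} = (1 - q^{n+1-i}) + q^{n+1-i}(1 - q^i): each bracket lowers one of the two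
    -- Gaussian factors by the recurrence. The second sum is then shifted by one, and `z1`, `z2`
    -- kill the boundary terms.
    have split : ∀ i ∈ Finset.range (n + 2),
        (1 - qpow ((n : ℚ) + 1)) * (qpow ((x - i) * ((n + 1 : ℕ) - i)) * gaussNat x i *
          gaussNat y (n + 1 - i))
        = qpow ((x - i) * ((n + 1 : ℕ) - i)) * gaussNat x i *
            ((1 - qpow ((n : ℚ) + 1 - i)) * gaussNat y (n + 1 - i)) +
          qpow ((x - i) * ((n + 1 : ℕ) - i) + (n + 1 - i)) *
            ((1 - qpow i) * gaussNat x i) * gaussNat y (n + 1 - i) := by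
      intro i _
      have e : qpow ((n : ℚ) + 1) = qpow ((n : ℚ) + 1 - i) * qpow i := by
        rw [← qpow_add]; ring_nf
      rw [e, qpow_add]
      ring
    rw [Finset.sum_congr rfl split, Finset.sum_add_distrib, Finset.sum_range_succ,
      Finset.sum_range_succ' (fun i : ℕ => qpow ((x - i) * ((n + 1 : ℕ) - i) + (n + 1 - i)) *
            ((1 - qpow i) * gaussNat x i) * gaussNat y (n + 1 - i))]
    have z1 : (1 : QSeries) - qpow ((n : ℚ) + 1 - (n + 1 : ℕ)) = 0 := by
      push_cast; rw [sub_self, qpow_zero, sub_self]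
    have z2 : (1 : QSeries) - qpow ((0 : ℕ) : ℚ) = 0 := by
      rw [Nat.cast_zero, qpow_zero, sub_self]
    rw [z1, z2, zero_mul, mul_zero, add_zero, zero_mul, mul_zero, zero_mul, add_zero,
      ← Finset.sum_add_distrib]
    refine Finset.sum_congr rfl fun i hi => ?_
    have hi' : i ≤ n := Nat.lt_succ_iff.1 (Finset.mem_range.1 hi)
    obtain ⟨k, rfl⟩ := Nat.exists_eq_add_of_le hi'
    have e1 : i + k + 1 - i = k + 1 := by omega
    have e2 : i + k + 1 - (i + 1) = k := by omega
    have e3 : i + k - i = k := by omega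
    have f1 : ((i + k : ℕ) : ℚ) + 1 - i = k + 1 := by push_cast; ring
    have f2 : ((i + 1 : ℕ) : ℚ) = i + 1 := by push_cast; ring
    rw [e1, e2, e3, f1, one_sub_mul_gaussNat_succ, f2, one_sub_mul_gaussNat_succ]
    have g1 : qpow ((x - i) * ((i + k + 1 : ℕ) - i)) =
        qpow ((x - i) * ((i + k : ℕ) - i)) * qpow (x - i) := by
      rw [← qpow_add]; push_cast; ring_nf
    have g2 : qpow ((x - (i + 1)) * ((i + k + 1 : ℕ) - (i + 1)) + ((i + k : ℕ) + 1 - (i + 1))) =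
        qpow ((x - i) * ((i + k : ℕ) - i)) := by
      congr 1; push_cast; ring
    have g3 : qpow (x + y - (i + k : ℕ)) = qpow (x - i) * qpow (y - k) := by
      rw [← qpow_add]; push_cast; ring_nf
    rw [g1, g2, g3]
    ring

/-- Both sides are the product of the m + i factors 1 - q^{x-k}, 0 ≤ k < m + i, divided by (q)_m
(q)_i. -/
lemma gauss_mul_gauss_of_nonneg (x : ℚ) {m i : ℤ} (hm : 0 ≤ m) (hi : 0 ≤ i) :
    gauss x m * gauss (x - m) i = gauss x (m + i) * gauss (m + i) i := by
  obtain ⟨m, rfl⟩ := Int.eq_ofNat_of_zero_le hm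
  obtain ⟨i, rfl⟩ := Int.eq_ofNat_of_zero_le hi
  have e : ((m : ℤ) + i : ℤ) = ((m + i : ℕ) : ℤ) := by push_cast; ring
  rw [e, gauss_natCast, gauss_natCast, gauss_natCast, gauss_natCast]
  push_cast
  have key : gaussNat ((m : ℚ) + i) i = qfac (m + i) / (qfac m * qfac i) := by
    have : qfac (m + i) = qfac m * ∏ j ∈ Finset.range i, (1 - qpow ((m : ℚ) + i - j)) := by
      rw [qfac, Finset.prod_range_add, ← qfac, ← Finset.prod_range_reflect]
      congr 1
      refine Finset.prod_congr rfl fun j hj => ?_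
      have hj' := Finset.mem_range.1 hj
      have : ((m + (i - 1 - j) : ℕ) : ℚ) = m + i - 1 - j := by
        rw [Nat.sub_sub]; push_cast [show 1 + j ≤ i by omega]; ring
      rw [this]; ring_nf
    rw [this, gaussNat]
    have := qfac_ne_zero m
    have := qfac_ne_zero i
    field_simp
  rw [key, gaussNat, gaussNat, gaussNat, Finset.prod_range_add]
  have h1 := qfac_ne_zero m
  have h2 := qfac_ne_zero i
  have h3 := qfac_ne_zero (m + i)
  have : ∀ j ∈ Finset.range i, (1 - qpow (x - (m + j : ℕ))) = 1 - qpow (x - m - j) := by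
    intro j _; congr 2; push_cast; ring
  rw [Finset.prod_congr rfl this]
  field_simp

/-- The numerator contains the factor 1 - q^0. This fails for negative n, which is where `gauss` and
`qbin` part ways. -/
lemma gauss_eq_zero_of_lt {n b : ℤ} (hn : 0 ≤ n) (hb : n < b) : gauss n b = 0 := by
  obtain ⟨n, rfl⟩ := Int.eq_ofNat_of_zero_le hn
  obtain ⟨b, rfl⟩ := Int.eq_ofNat_of_zero_le (hn.trans hb.le)
  rw [gauss_natCast, gaussNat, Finset.prod_eq_zero (i := n), zero_div]
  · simpa using hb
  · simp [qpow_zero]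

lemma gauss_natCast_add (k l : ℕ) :
    gauss ((k : ℚ) + l) k = qfac (k + l) / (qfac k * qfac l) := by
  have h : qfac (k + l) = qfac l * ∏ j ∈ Finset.range k, (1 - qpow ((k : ℚ) + l - j)) := by
    rw [add_comm k l, qfac, Finset.prod_range_add, ← qfac, ← Finset.prod_range_reflect]
    congr 1
    refine Finset.prod_congr rfl fun j hj => ?_
    have hj' := Finset.mem_range.1 hj
    have : ((l + (k - 1 - j) : ℕ) : ℚ) = l + k - 1 - j := by
      rw [Nat.sub_sub]; push_cast [show 1 + j ≤ k by omega]; ring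
    rw [this]; ring_nf
  have h1 := qfac_ne_zero k
  have h2 := qfac_ne_zero l
  rw [h, gauss_natCast, gaussNat]
  field_simp

lemma gauss_symm {n b : ℤ} (hn : 0 ≤ n) : gauss n b = gauss n (n - b) := by
  rcases lt_or_ge b 0 with hb | hb
  · rw [gauss_of_neg _ hb, gauss_eq_zero_of_lt hn (by omega)]
  rcases lt_or_ge n b with hb' | hb'
  · rw [gauss_eq_zero_of_lt hn hb', gauss_of_neg _ (by omega)]
  obtain ⟨b, rfl⟩ := Int.eq_ofNat_of_zero_le hb
  obtain ⟨c, rfl⟩ := Int.le.dest hb'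
  have e : ((b : ℤ) + c - b) = c := by ring
  have h1 := gauss_natCast_add b c
  have h2 := gauss_natCast_add c b
  rw [e]
  push_cast
  rw [h1, add_comm (b : ℚ), h2, add_comm b, mul_comm]

lemma gauss_mul_gauss (x : ℚ) (m i : ℤ) :
    gauss x m * gauss (x - m) i = gauss x (m + i) * gauss (m + i) i := by
  rcases lt_or_ge i 0 with hi | hi
  · rw [gauss_of_neg _ hi, gauss_of_neg _ hi, mul_zero, mul_zero]
  rcases lt_or_ge m 0 with hm | hm
  · rw [gauss_of_neg _ hm, zero_mul]
    rcases lt_or_ge (m + i) 0 with h | h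
    · rw [gauss_of_neg _ h, zero_mul]
    · have := gauss_eq_zero_of_lt h (show m + i < i by omega)
      push_cast at this
      rw [this, mul_zero]
  · exact gauss_mul_gauss_of_nonneg x hm hi

/-- The `q`-Vandermonde sum over any set of indices that contains the nonzero terms. -/
lemma gauss_vandermonde (x y : ℚ) (n : ℤ) (S : Finset ℤ)
    (hS : ∀ i, gauss x i ≠ 0 → gauss y (n - i) ≠ 0 → i ∈ S) :
    ∑ i ∈ S, qpow ((x - i) * (n - i)) * gauss x i * gauss y (n - i) = gauss (x + y) n := by
  have h1 : ∑ i ∈ S, qpow ((x - i) * (n - i)) * gauss x i * gauss y (n - i) =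
      ∑ i ∈ Finset.Icc 0 n, qpow ((x - i) * (n - i)) * gauss x i * gauss y (n - i) := by
    have aux : ∀ i : ℤ, qpow ((x - i) * (n - i)) * gauss x i * gauss y (n - i) ≠ 0 →
        i ∈ S ∧ i ∈ Finset.Icc 0 n := by
      intro i hi
      have ha := right_ne_zero_of_mul (left_ne_zero_of_mul hi)
      have hb := right_ne_zero_of_mul hi
      have := gauss_ne_zero_bot ha
      have := gauss_ne_zero_bot hb
      exact ⟨hS i ha hb, Finset.mem_Icc.2 ⟨by omega, by omega⟩⟩
    rw [← Finset.sum_subset (Finset.inter_subset_left (s₁ := S) (s₂ := Finset.Icc 0 n)),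
      ← Finset.sum_subset (Finset.inter_subset_right (s₁ := S) (s₂ := Finset.Icc 0 n))]
    · intro i _ hi
      by_contra h
      exact hi (Finset.mem_inter.2 (aux i h))
    · intro i _ hi
      by_contra h
      exact hi (Finset.mem_inter.2 (aux i h))
  rw [h1]
  rcases lt_or_ge n 0 with hn | hn
  · rw [gauss_of_neg _ hn, Finset.Icc_eq_empty (by omega), Finset.sum_empty]
  obtain ⟨n, rfl⟩ := Int.eq_ofNat_of_zero_le hn
  rw [gauss_natCast, ← gaussNat_vandermonde]
  symm
  refine Finset.sum_bij (fun i _ => (i : ℤ)) ?_ ?_ ?_ ?_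
  · intro i hi
    have := Finset.mem_range.1 hi
    exact Finset.mem_Icc.2 ⟨by omega, by omega⟩
  · intro i _ j _ h
    exact_mod_cast h
  · intro i hi
    have := Finset.mem_Icc.1 hi
    exact ⟨i.toNat, Finset.mem_range.2 (by omega), by simp [this.1]⟩
  · intro i hi
    have := Finset.mem_range.1 hi
    have e : ((n : ℤ) - i) = ((n - i : ℕ) : ℤ) := by omega
    rw [e, gauss_natCast, gauss_natCast]
    simp

lemma gauss_vandermonde' (x y : ℚ) (n : ℤ) (S : Finset ℤ)
    (hS : ∀ i, gauss y i ≠ 0 → gauss x (n - i) ≠ 0 → i ∈ S) :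
    ∑ i ∈ S, qpow (i * (x - n + i)) * gauss x (n - i) * gauss y i = gauss (x + y) n := by
  rw [← gauss_vandermonde x y n (S.map (Equiv.subLeft n).toEmbedding), Finset.sum_map]
  · refine Finset.sum_congr rfl fun i _ => ?_
    simp only [Equiv.coe_toEmbedding, Equiv.subLeft_apply, sub_sub_cancel]
    push_cast
    congr 3
    ring
  · intro i hi hj
    refine Finset.mem_map.2 ⟨n - i, hS _ hj (by simpa using hi), by simp⟩

/-- The `q`-Saalschütz sum. -/
theorem gauss_saalschutz (x y : ℚ) (a b : ℤ) (S : Finset ℤ) (hS : Finset.Icc 0 b ⊆ S) :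
    ∑ j ∈ S, qpow ((a - j) * (b - j)) * gauss (x + y + j) j * gauss x (a - j) * gauss y (b - j)
      = gauss (x + b) a * gauss (y + a) b := by
  rcases lt_or_ge b 0 with hb | hb
  · rw [gauss_of_neg _ hb, mul_zero]
    refine Finset.sum_eq_zero fun j _ => ?_
    rcases lt_or_ge j 0 with hj | hj
    · rw [gauss_of_neg _ hj]; ring
    · rw [gauss_of_neg y (by omega)]; ring
  have hsub : ∑ j ∈ S, qpow ((a - j) * (b - j)) * gauss (x + y + j) j * gauss x (a - j) *
      gauss y (b - j) = ∑ j ∈ Finset.Icc 0 b, qpow ((a - j) * (b - j)) * gauss (x + y + j) j *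
      gauss x (a - j) * gauss y (b - j) := by
    symm
    refine Finset.sum_subset hS fun j _ hj => ?_
    rcases lt_or_ge j 0 with h | h
    · rw [gauss_of_neg _ h]; ring
    · rw [gauss_of_neg y (by rw [Finset.mem_Icc] at hj; omega)]; ring
  rw [hsub]
  -- The split x + y + j = (x - a + j) + (y + a) is chosen so that, after q-Vandermonde, the factor
  -- with lower entry j - t merges with `gauss x (a - j)` and leaves j only in a second
  -- q-Vandermonde sum.
  have expand : ∀ j ∈ Finset.Icc 0 b, qpow ((a - j) * (b - j)) * gauss (x + y + j) j *
      gauss x (a - j) * gauss y (b - j) = ∑ t ∈ Finset.Icc 0 b,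
        qpow (t * (x - a + t)) * gauss x (a - t) * gauss (y + a) t *
        (qpow (((a - t : ℤ) - (j - t : ℤ)) * ((b - t : ℤ) - (j - t : ℤ))) *
          gauss (a - t : ℤ) (j - t) * gauss y (b - t - (j - t))) := by
    intro j hj
    rw [Finset.mem_Icc] at hj
    have e : x + y + j = (x - a + j) + (y + a) := by ring
    rw [e, ← gauss_vandermonde' (x - a + j) (y + a) j (Finset.Icc 0 b), Finset.mul_sum,
      Finset.sum_mul, Finset.sum_mul]
    · refine Finset.sum_congr rfl fun t _ => ?_
      have h := gauss_mul_gauss x (a - j) (j - t)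
      have e1 : a - j + (j - t) = a - t := by ring
      have e2 : x - ((a - j : ℤ) : ℚ) = x - a + j := by push_cast; ring
      have e3 : (((a - j : ℤ) : ℚ)) + ((j - t : ℤ) : ℚ) = (a - t : ℤ) := by push_cast; ring
      have e4 : b - t - (j - t) = b - j := by ring
      have e5 : (((a - t : ℤ) : ℚ) - (j - t : ℤ)) * ((b - t : ℤ) - (j - t : ℤ))
          = (a - j) * (b - j) := by push_cast; ring
      have e6 : (t : ℚ) * (x - a + j - j + t) = t * (x - a + t) := by ring
      rw [e1, e2, e3] at h
      rw [e4, e5, e6]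
      linear_combination qpow ((a - j) * (b - j)) * qpow (t * (x - a + t)) * gauss (y + a) t *
        gauss y (b - j) * h
    · intro i h1 h2
      have := gauss_ne_zero_bot h1
      have := gauss_ne_zero_bot h2
      exact Finset.mem_Icc.2 ⟨by omega, by omega⟩
  rw [Finset.sum_congr rfl expand, Finset.sum_comm]
  -- The sum over j has top entries a - t and y. Its value joins `gauss (y + a) t`, so `gauss (y +
  -- a) b` comes out of the sum over t, and what remains is a third q-Vandermonde sum.
  have inner : ∀ t ∈ Finset.Icc 0 b, ∑ j ∈ Finset.Icc 0 b,
      qpow (t * (x - a + t)) * gauss x (a - t) * gauss (y + a) t *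
        (qpow (((a - t : ℤ) - (j - t : ℤ)) * ((b - t : ℤ) - (j - t : ℤ))) *
          gauss (a - t : ℤ) (j - t) * gauss y (b - t - (j - t)))
      = qpow (t * (x - a + t)) * gauss x (a - t) * gauss b t * gauss (y + a) b := by
    intro t ht
    rw [Finset.mem_Icc] at ht
    have h := gauss_vandermonde (a - t : ℤ) y (b - t)
      ((Finset.Icc 0 b).map (Equiv.subRight t).toEmbedding) (by
        intro i h1 h2
        have := gauss_ne_zero_bot h1
        have := gauss_ne_zero_bot h2
        exact Finset.mem_map.2 ⟨i + t, Finset.mem_Icc.2 ⟨by omega, by omega⟩, by simp⟩)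
    rw [Finset.sum_map] at h
    simp only [Equiv.coe_toEmbedding, Equiv.subRight_apply] at h
    rw [← Finset.mul_sum, h]
    have h' := gauss_mul_gauss (y + a) t (b - t)
    have e1 : t + (b - t) = b := by ring
    have e2 : (y + a - t : ℚ) = ((a - t : ℤ) : ℚ) + y := by push_cast; ring
    have e3 : (t : ℚ) + ((b - t : ℤ) : ℚ) = b := by push_cast; ring
    rw [e1, e2, e3, ← gauss_symm hb] at h'
    linear_combination qpow (t * (x - a + t)) * gauss x (a - t) * h'
  rw [Finset.sum_congr rfl inner, ← Finset.sum_mul]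
  congr 1
  apply gauss_vandermonde'
  intro i h1 _
  have := gauss_ne_zero_bot h1
  refine Finset.mem_Icc.2 ⟨this, ?_⟩
  by_contra h
  exact h1 (gauss_eq_zero_of_lt hb (by omega))

/-- The exchange of summation variables that removes one vertex from a chain. -/
theorem gauss_exchange (A B : ℚ) (K M l s : ℤ) :
    ∑ j ∈ Finset.Icc 0 M, qpow ((K - l + M - 2 * j) ^ 2 / 4) * gauss (A + l / 2 + j) K *
        gauss (B + K - l / 2) j * gauss ((K - M + s) / 2) (l - M + j) *
        gauss (B + (K - l + M + s) / 2 - j) (M - j)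
      = ∑ j ∈ Finset.Icc 0 M, qpow ((K + M - 2 * j - l) ^ 2 / 4) * gauss (A + B + j) j *
        gauss (A + l / 2) (K - j) * gauss (B + l / 2) (M - j) *
        gauss ((K + M + s) / 2 - j) l := by
  -- The first two Gaussian factors are a q-Saalschütz product, which is expanded as a sum over j.
  -- For fixed j the sum over i is again of q-Saalschütz type, with summation variable M - i.
  have expand : ∀ i ∈ Finset.Icc 0 M, qpow ((K - l + M - 2 * i) ^ 2 / 4) *
        gauss (A + l / 2 + i) K * gauss (B + K - l / 2) i * gauss ((K - M + s) / 2) (l - M + i) *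
        gauss (B + (K - l + M + s) / 2 - i) (M - i)
      = ∑ j ∈ Finset.Icc 0 M, qpow ((K + M - 2 * j - l) ^ 2 / 4) * gauss (A + B + j) j *
        gauss (A + l / 2) (K - j) * (qpow ((l - (M - i : ℤ)) * ((M - j : ℤ) - (M - i : ℤ))) *
          gauss ((K - M + s) / 2 + (B - l / 2) + (M - i : ℤ)) (M - i) *
          gauss ((K - M + s) / 2) (l - (M - i)) * gauss (B - l / 2) (M - j - (M - i))) := by
    intro i hi
    rw [Finset.mem_Icc] at hi
    have h := gauss_saalschutz (A + l / 2) (B - l / 2) K i (Finset.Icc 0 M)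
      (Finset.Icc_subset_Icc le_rfl hi.2)
    have e1 : B + K - l / 2 = B - l / 2 + K := by ring
    have e2 : qpow ((K - l + M - 2 * i) ^ 2 / 4) * gauss (A + l / 2 + i) K *
        gauss (B + K - l / 2) i = qpow ((K - l + M - 2 * i) ^ 2 / 4) *
        (gauss (A + l / 2 + i) K * gauss (B + K - l / 2) i) := by ring
    rw [e2, e1, ← h, Finset.mul_sum, Finset.sum_mul, Finset.sum_mul]
    refine Finset.sum_congr rfl fun j _ => ?_
    have e3 : A + l / 2 + (B - l / 2) + j = A + B + j := by ring
    have e4 : M - j - (M - i) = i - j := by ring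
    have e5 : l - (M - i) = l - M + i := by ring
    have e6 : (K - M + s) / 2 + (B - l / 2) + ((M - i : ℤ) : ℚ)
        = B + (K - l + M + s) / 2 - i := by push_cast; ring
    have e7 : qpow ((K - l + M - 2 * i) ^ 2 / 4) * qpow ((K - j) * (i - j)) =
        qpow ((K + M - 2 * j - l) ^ 2 / 4) *
        qpow ((l - (M - i : ℤ)) * ((M - j : ℤ) - (M - i : ℤ))) := by
      rw [← qpow_add, ← qpow_add]; push_cast; ring_nf
    rw [e3, e4, e5, e6]
    linear_combination gauss (A + B + j) j * gauss (A + l / 2) (K - j) *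
      gauss (B - l / 2) (i - j) * gauss ((K - M + s) / 2) (l - M + i) *
      gauss (B + (K - l + M + s) / 2 - i) (M - i) * e7
  rw [Finset.sum_congr rfl expand, Finset.sum_comm]
  refine Finset.sum_congr rfl fun j hj => ?_
  rw [Finset.mem_Icc] at hj
  have h := gauss_saalschutz ((K - M + s) / 2) (B - l / 2) l (M - j)
    ((Finset.Icc 0 M).map (Equiv.subLeft M).toEmbedding) (by
      intro i hi
      rw [Finset.mem_Icc] at hi
      exact Finset.mem_map.2 ⟨M - i, Finset.mem_Icc.2 ⟨by omega, by omega⟩, by simp⟩)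
  rw [Finset.sum_map] at h
  simp only [Equiv.coe_toEmbedding, Equiv.subLeft_apply] at h
  rw [← Finset.mul_sum, h]
  have e1 : (K - M + s) / 2 + ((M - j : ℤ) : ℚ) = (K + M + s) / 2 - j := by push_cast; ring
  have e2 : B - l / 2 + l = B + l / 2 := by ring
  rw [e1, e2]
  ring

/-! ### Chains, their weights, and sums over boxes -/

/-- The sequence `a, m_1, …, m_n, b, b, …`. -/
def ext {n : ℕ} (a : ℤ) (m : Fin n → ℤ) (b : ℤ) : ℕ → ℤ
  | 0 => a
  | j + 1 => if h : j < n then m ⟨j, h⟩ else b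

lemma ext_zero {n : ℕ} (a : ℤ) (m : Fin n → ℤ) (b : ℤ) : ext a m b 0 = a := rfl

lemma ext_succ {n : ℕ} (a : ℤ) (m : Fin n → ℤ) (b : ℤ) (k : Fin n) :
    ext a m b (k + 1) = m k := by simp [ext]

lemma ext_last {n : ℕ} (a : ℤ) (m : Fin n → ℤ) (b : ℤ) : ext a m b (n + 1) = b := by simp [ext]

lemma ext_cons_succ {n : ℕ} (a x : ℤ) (m : Fin n → ℤ) (b : ℤ) (j : ℕ) :
    ext a (Fin.cons x m : Fin (n + 1) → ℤ) b (j + 1) = ext x m b j := by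
  cases j with
  | zero => simp [ext]
  | succ j =>
    by_cases h : j < n
    · have : (⟨j + 1, by omega⟩ : Fin (n + 1)) = Fin.succ ⟨j, h⟩ := rfl
      simp only [ext, h, add_lt_add_iff_right, dite_true]
      rw [this, Fin.cons_succ]
    · simp [ext, h]

lemma ext_rev {n : ℕ} (a : ℤ) (m : Fin n → ℤ) (b : ℤ) {j : ℕ} (hj : j ≤ n + 1) :
    ext b (m ∘ Fin.rev) a j = ext a m b (n + 1 - j) := by
  cases j with
  | zero => simp [ext]
  | succ j =>
    by_cases h : j < n
    · obtain ⟨i, rfl⟩ : ∃ i, n = j + i + 1 := ⟨n - j - 1, by omega⟩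
      have e : j + i + 1 + 1 - (j + 1) = i + 1 := by omega
      have h' : i < j + i + 1 := by omega
      rw [e]
      simp only [ext, h, h', dite_true, Function.comp]
      congr 1
      ext
      simp [Fin.rev]
    · obtain rfl : j = n := by omega
      simp [ext]

/-- The weight of an edge of a chain, with the parity restriction. -/
noncomputable def edge (σ x y : ℤ) : QSeries :=
  if Even (x - y - σ) then qpow ((x - y : ℚ) ^ 2 / 4) else 0

lemma even_of_edge_ne_zero {σ x y : ℤ} (h : edge σ x y ≠ 0) : Even (x - y - σ) := by
  by_contra h'
  exact h (if_neg h')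

lemma edge_comm (σ x y : ℤ) : edge σ x y = edge σ y x := by
  have h : Even (x - y - σ) ↔ Even (y - x - σ) := by
    constructor <;> rintro ⟨z, hz⟩
    · exact ⟨-z - σ, by omega⟩
    · exact ⟨-z - σ, by omega⟩
  simp only [edge, h]
  congr 2
  ring

/-- The weight of the chain `a, m_1, …, m_n, b`. -/
noncomputable def chain {n : ℕ} (σ a : ℤ) (m : Fin n → ℤ) (b : ℤ) : QSeries :=
  (∏ j ∈ Finset.range (n + 1), edge σ (ext a m b j) (ext a m b (j + 1))) *
    ∏ j ∈ Finset.range n, gauss ((ext a m b j + ext a m b (j + 2)) / 2) (ext a m b (j + 1))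

lemma chain_zero (σ a : ℤ) (m : Fin 0 → ℤ) (b : ℤ) : chain σ a m b = edge σ a b := by
  simp [chain, ext]

lemma chain_cons {n : ℕ} (σ a x : ℤ) (m : Fin n → ℤ) (b : ℤ) :
    chain σ a (Fin.cons x m : Fin (n + 1) → ℤ) b =
      edge σ a x * gauss ((a + ext x m b 1) / 2) x * chain σ x m b := by
  rw [chain, Finset.prod_range_succ' _ (n + 1), Finset.prod_range_succ' (fun j : ℕ =>
    gauss ((ext a (Fin.cons x m : Fin (n + 1) → ℤ) b j +
      ext a (Fin.cons x m : Fin (n + 1) → ℤ) b (j + 2)) / 2)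
      (ext a (Fin.cons x m : Fin (n + 1) → ℤ) b (j + 1))) n]
  simp only [ext_cons_succ, ext_zero, chain]
  ring

lemma chain_rev {n : ℕ} (σ a : ℤ) (m : Fin n → ℤ) (b : ℤ) :
    chain σ b (m ∘ Fin.rev) a = chain σ a m b := by
  rw [chain, chain]
  congr 1
  · rw [← Finset.prod_range_reflect]
    refine Finset.prod_congr rfl fun j hj => ?_
    have := Finset.mem_range.1 hj
    rw [ext_rev _ _ _ (by omega), ext_rev _ _ _ (by omega), edge_comm]
    congr 2 <;> omega
  · rw [← Finset.prod_range_reflect]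
    refine Finset.prod_congr rfl fun j hj => ?_
    have := Finset.mem_range.1 hj
    rw [ext_rev _ _ _ (by omega), ext_rev _ _ _ (by omega), ext_rev _ _ _ (by omega), add_comm]
    congr 4 <;> congr 1 <;> omega

/-- The integer vectors with all entries between `0` and `T`. -/
noncomputable def box (n : ℕ) (T : ℤ) : Finset (Fin n → ℤ) := Fintype.piFinset fun _ => Finset.Icc 0 T

lemma mem_box {n : ℕ} {T : ℤ} {m : Fin n → ℤ} : m ∈ box n T ↔ ∀ k, 0 ≤ m k ∧ m k ≤ T := by
  simp [box, Fintype.mem_piFinset]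

lemma sum_box_succ {n : ℕ} (T : ℤ) (F : (Fin (n + 1) → ℤ) → QSeries) :
    ∑ m ∈ box (n + 1) T, F m
      = ∑ x ∈ Finset.Icc 0 T, ∑ m ∈ box n T, F (Fin.cons x m) := by
  rw [← Finset.sum_product']
  refine Finset.sum_bij' (fun m _ => (m 0, Fin.tail m)) (fun p _ => Fin.cons p.1 p.2)
    ?_ ?_ ?_ ?_ ?_
  · intro m hm
    rw [mem_box] at hm
    exact Finset.mem_product.2 ⟨Finset.mem_Icc.2 (hm 0), mem_box.2 fun k => hm k.succ⟩
  · intro p hp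
    obtain ⟨h1, h2⟩ := Finset.mem_product.1 hp
    rw [Finset.mem_Icc] at h1
    rw [mem_box] at h2 ⊢
    intro k
    refine Fin.cases ?_ (fun k => ?_) k
    · simpa using h1
    · simpa using h2 k
  · intro m _
    exact Fin.cons_self_tail m
  · intro p _
    simp
  · intro m _
    rw [Fin.cons_self_tail]

lemma sum_box_zero (T : ℤ) (F : (Fin 0 → ℤ) → QSeries) : ∑ m ∈ box 0 T, F m = F ![] := by
  have : box 0 T = {![]} := by
    ext m
    simp only [mem_box, Finset.mem_singleton]
    exact ⟨fun _ => Subsingleton.elim _ _, fun _ k => k.elim0⟩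
  rw [this, Finset.sum_singleton]

lemma sum_box_rev {n : ℕ} (T : ℤ) (F : (Fin n → ℤ) → QSeries) :
    ∑ m ∈ box n T, F (m ∘ Fin.rev) = ∑ m ∈ box n T, F m := by
  refine Finset.sum_bij' (fun m _ => m ∘ Fin.rev) (fun m _ => m ∘ Fin.rev) ?_ ?_ ?_ ?_ ?_
  · intro m hm
    rw [mem_box] at hm ⊢
    exact fun k => hm _
  · intro m hm
    rw [mem_box] at hm ⊢
    exact fun k => hm _
  · intro m _
    funext k
    simp
  · intro m _
    funext k
    simp
  · intro m _
    rfl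

lemma sum_eq_sum_of_ne_zero {ι : Type*} [DecidableEq ι] {S S' : Finset ι} (f : ι → QSeries)
    (h : ∀ i ∈ S, f i ≠ 0 → i ∈ S') (h' : ∀ i ∈ S', f i ≠ 0 → i ∈ S) :
    ∑ i ∈ S, f i = ∑ i ∈ S', f i := by
  rw [← Finset.sum_subset (Finset.inter_subset_left (s₁ := S) (s₂ := S')),
    ← Finset.sum_subset (Finset.inter_subset_right (s₁ := S) (s₂ := S'))]
  · intro i hi hn
    by_contra h0
    exact hn (Finset.mem_inter.2 ⟨h' i hi h0, hi⟩)
  · intro i hi hn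
    by_contra h0
    exact hn (Finset.mem_inter.2 ⟨hi, h i hi h0⟩)

/-! ### Convexity of chains with nonzero weight -/

/-- A convex sequence that is nonpositive at both ends is nonpositive. -/
lemma nonpos_of_convex (f : ℕ → ℚ) (n : ℕ)
    (hf : ∀ k < n, 0 ≤ f k - 2 * f (k + 1) + f (k + 2)) (h0 : f 0 ≤ 0) (hn : f (n + 1) ≤ 0) :
    ∀ j ≤ n + 1, f j ≤ 0 := by
  by_contra! h
  classical
  obtain ⟨hj, hpos⟩ := Nat.find_spec h
  have hmin : ∀ i, i < Nat.find h → f i ≤ 0 := fun i hi => by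
    by_contra! hc
    exact Nat.find_min h hi ⟨by omega, hc⟩
  generalize Nat.find h = j at hj hpos hmin
  cases j with
  | zero => linarith
  | succ j =>
    -- At the first positive entry the increment is positive, and convexity keeps it positive up to
    -- the right end.
    have step : ∀ i, j + i ≤ n → f (j + i) < f (j + i + 1) ∧ 0 < f (j + i + 1) := by
      intro i
      induction i with
      | zero => exact fun _ => ⟨(hmin j (by omega)).trans_lt hpos, hpos⟩
      | succ i ih =>
        intro hi
        obtain ⟨h1, h2⟩ := ih (by omega)
        have := hf (j + i) (by omega)
        rw [show j + (i + 1) = j + i + 1 by ring]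
        constructor <;> linarith
    have := (step (n - j) (by omega)).2
    rw [show j + (n - j) + 1 = n + 1 by omega] at this
    linarith

lemma le_line_of_convex (f : ℕ → ℚ) (n : ℕ)
    (hf : ∀ k < n, 0 ≤ f k - 2 * f (k + 1) + f (k + 2)) {j : ℕ} (hj : j ≤ n + 1) :
    f j ≤ f 0 + (f (n + 1) - f 0) * j / (n + 1) := by
  have hn : (n : ℚ) + 1 ≠ 0 := by positivity
  have := nonpos_of_convex (fun i => f i - (f 0 + (f (n + 1) - f 0) * i / (n + 1))) n
    (fun k hk => by
      have := hf k hk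
      push_cast
      ring_nf at this ⊢
      linarith) (by simp) (by push_cast; field_simp; linarith) j hj
  simpa using this

section chain
variable {n : ℕ} {σ a b : ℤ} {m : Fin n → ℤ}

lemma ext_even_of_chain_ne_zero (h : chain σ a m b ≠ 0) {j : ℕ} (hj : j ≤ n) :
    Even (ext a m b j - ext a m b (j + 1) - σ) :=
  even_of_edge_ne_zero
    (Finset.prod_ne_zero_iff.1 (left_ne_zero_of_mul h) j (Finset.mem_range.2 (by omega)))

lemma ext_nonneg (hm : ∀ k, 0 ≤ m k) (ha : 0 ≤ a) (hb : 0 ≤ b) (j : ℕ) : 0 ≤ ext a m b j := by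
  cases j with
  | zero => exact ha
  | succ j =>
    by_cases hj : j < n
    · simpa [ext, hj] using hm ⟨j, hj⟩
    · simpa [ext, hj] using hb

lemma ext_nonneg_of_chain_ne_zero (h : chain σ a m b ≠ 0) (ha : 0 ≤ a) (hb : 0 ≤ b) (j : ℕ) :
    0 ≤ ext a m b j := by
  refine ext_nonneg (fun k => ?_) ha hb j
  have := gauss_ne_zero_bot
    (Finset.prod_ne_zero_iff.1 (right_ne_zero_of_mul h) k (Finset.mem_range.2 k.2))
  rwa [ext_succ] at this

/-- Consecutive edges have the same parity σ, so entries two steps apart are congruent modulo 2.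
This makes the top entries in the chain weight integers. -/
lemma exists_half_of_chain_ne_zero (h : chain σ a m b ≠ 0) {k : ℕ} (hk : k < n) :
    ∃ z : ℤ, ext a m b k + ext a m b (k + 2) = 2 * z := by
  obtain ⟨u, hu⟩ := ext_even_of_chain_ne_zero h (j := k) (by omega)
  obtain ⟨v, hv⟩ := ext_even_of_chain_ne_zero h (j := k + 1) (by omega)
  exact ⟨u - v + ext a m b (k + 1), by rw [show k + 2 = k + 1 + 1 by ring]; omega⟩

/-- The top entry at a vertex is the mean of its neighbours, here a nonnegative integer, so a
nonzero Gaussian factor forces the vertex to lie below that mean. -/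
lemma ext_convex_of_chain_ne_zero (h : chain σ a m b ≠ 0) (ha : 0 ≤ a) (hb : 0 ≤ b)
    {k : ℕ} (hk : k < n) : 2 * ext a m b (k + 1) ≤ ext a m b k + ext a m b (k + 2) := by
  have h1 := Finset.prod_ne_zero_iff.1 (right_ne_zero_of_mul h) k (Finset.mem_range.2 hk)
  obtain ⟨z, hz⟩ := exists_half_of_chain_ne_zero h hk
  have e : ((ext a m b k : ℚ) + ext a m b (k + 2)) / 2 = z := by
    rw [← Int.cast_add, hz]; push_cast; ring
  rw [e] at h1
  have := ext_nonneg_of_chain_ne_zero h ha hb k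
  have := ext_nonneg_of_chain_ne_zero h ha hb (k + 2)
  by_contra hc
  exact h1 (gauss_eq_zero_of_lt (by omega) (by omega))

/-- A convex chain lies below its chord. Used at the entries next to the ends, this gives the bounds
with the factor 1 + 1/N in `Admissible`. -/
lemma ext_le_line_of_chain_ne_zero (h : chain σ a m b ≠ 0) (ha : 0 ≤ a) (hb : 0 ≤ b)
    {j : ℕ} (hj : j ≤ n + 1) : (ext a m b j : ℚ) ≤ a + ((b : ℚ) - a) * j / (n + 1) := by
  have := le_line_of_convex (fun i => (ext a m b i : ℚ)) n (fun k hk => by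
    have := ext_convex_of_chain_ne_zero h ha hb hk
    have : (2 * ext a m b (k + 1) : ℚ) ≤ ext a m b k + ext a m b (k + 2) := by exact_mod_cast this
    linarith) hj
  simpa [ext_last, ext_zero] using this

lemma ext_one_le_of_chain_ne_zero (h : chain σ a m 0 ≠ 0) (ha : 0 ≤ a) : ext a m 0 1 ≤ a := by
  have h1 := ext_le_line_of_chain_ne_zero h ha le_rfl (j := 1) (by omega)
  have h2 : ((0 : ℤ) - a : ℚ) * (1 : ℕ) / (n + 1) ≤ 0 := by
    apply div_nonpos_of_nonpos_of_nonneg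
    · have : (0 : ℚ) ≤ a := by exact_mod_cast ha
      push_cast; linarith
    · positivity
  have : (ext a m 0 1 : ℚ) ≤ a := by linarith
  exact_mod_cast this

end chain

/-! ### The generalized q-Saalschütz sum for `gauss` -/

/-- The sum over chains from `K` to `M`. -/
noncomputable def chainSum (n : ℕ) (σ T : ℤ) (A B : ℚ) (K M : ℤ) : QSeries :=
  ∑ m ∈ box n T, chain σ K m M * gauss (A + (M + ext K m M 1) / 2) K *
    gauss (B + (K + ext K m M n) / 2) M

/-- The sum over chains from `K + M - 2 j` to `0`. -/
noncomputable def dualChainSum (n : ℕ) (σ T : ℤ) (A B : ℚ) (K M : ℤ) : QSeries :=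
  ∑ j ∈ Finset.Icc 0 T, gauss (A + B + j) j * ∑ m ∈ box n (2 * T),
    chain σ (K + M - 2 * j) m 0 * gauss (A + ext (K + M - 2 * j) m 0 1 / 2) (K - j) *
      gauss (B + ext (K + M - 2 * j) m 0 1 / 2) (M - j)

lemma chainSum_comm (n : ℕ) (σ T : ℤ) (A B : ℚ) (K M : ℤ) :
    chainSum n σ T A B K M = chainSum n σ T B A M K := by
  rw [chainSum, chainSum, ← sum_box_rev]
  refine Finset.sum_congr rfl fun m _ => ?_
  rw [chain_rev, ext_rev _ _ _ (by omega), ext_rev _ _ _ (by omega), Nat.add_sub_cancel,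
    Nat.add_sub_cancel_left]
  ring

lemma dualChainSum_comm (n : ℕ) (σ T : ℤ) (A B : ℚ) (K M : ℤ) :
    dualChainSum n σ T A B K M = dualChainSum n σ T B A M K := by
  unfold dualChainSum
  rw [add_comm B A, add_comm M K]
  refine Finset.sum_congr rfl fun j _ => congrArg _ (Finset.sum_congr rfl fun m _ => ?_)
  exact mul_right_comm _ _ _

/-- The range up to T keeps the definition symmetric in K and M; the range up to M is the one that
`gauss_exchange` works with. The extra terms have a negative lower entry. -/
lemma dualChainSum_eq_sum_Icc (n : ℕ) (σ T : ℤ) (A B : ℚ) {K M : ℤ} (hM : M ≤ T) :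
    dualChainSum n σ T A B K M =
      ∑ j ∈ Finset.Icc 0 M, gauss (A + B + j) j * ∑ m ∈ box n (2 * T),
        chain σ (K + M - 2 * j) m 0 * gauss (A + ext (K + M - 2 * j) m 0 1 / 2) (K - j) *
          gauss (B + ext (K + M - 2 * j) m 0 1 / 2) (M - j) := by
  symm
  refine Finset.sum_subset (Finset.Icc_subset_Icc le_rfl hM) fun j h1 h2 => ?_
  rw [Finset.mem_Icc] at h1 h2
  rw [Finset.sum_eq_zero, mul_zero]
  intro m _
  rw [gauss_of_neg _ (show M - j < 0 by omega), mul_zero]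

/-- This is the q-Saalschütz sum: the edge weights match because (K + M - 2j)² - (K - M)² = 4(K -
j)(M - j). -/
lemma chainSum_zero (σ T : ℤ) (A B : ℚ) {K M : ℤ} (hM : M ≤ T) :
    chainSum 0 σ T A B K M = dualChainSum 0 σ T A B K M := by
  rw [chainSum, dualChainSum_eq_sum_Icc _ _ _ _ _ hM, sum_box_zero]
  simp only [sum_box_zero, chain_zero]
  have h := gauss_saalschutz A B K M (Finset.Icc 0 M) subset_rfl
  have e1 : A + ((M : ℚ) + ext K ![] M 1) / 2 = A + M := by simp [ext]
  have e2 : B + ((K : ℚ) + ext K ![] M 0) / 2 = B + K := by simp [ext]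
  rw [e1, e2, mul_assoc, ← h, Finset.mul_sum]
  refine Finset.sum_congr rfl fun j _ => ?_
  have e3 : ((ext (K + M - 2 * j) ![] 0 1 : ℤ) : ℚ) / 2 = 0 := by simp [ext]
  rw [e3, add_zero, add_zero]
  have e4 : edge σ (K + M - 2 * j) 0 = edge σ K M * qpow ((K - j) * (M - j)) := by
    have : Even (K + M - 2 * j - 0 - σ) ↔ Even (K - M - σ) := by
      constructor <;> rintro ⟨z, hz⟩
      · exact ⟨z - M + j, by omega⟩
      · exact ⟨z + M - j, by omega⟩
    rw [edge, edge]
    simp only [this]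
    split_ifs
    · rw [← qpow_add]
      congr 1
      push_cast
      ring
    · simp
  rw [e4]
  ring

/-- Once K is removed, the Gaussian factor at its neighbour x serves as the left end factor of the
shorter chain, which is why A becomes (K - M)/2. -/
lemma chainSum_succ (n : ℕ) (σ T : ℤ) (A B : ℚ) (K M : ℤ) :
    chainSum (n + 1) σ T A B K M = ∑ x ∈ Finset.Icc 0 T, edge σ K x *
      gauss (A + (M + x) / 2) K *
        chainSum n σ T ((K - M) / 2) (B + (K - x) / 2) x M := by
  rw [chainSum, sum_box_succ]
  refine Finset.sum_congr rfl fun x _ => ?_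
  rw [chainSum, Finset.mul_sum]
  refine Finset.sum_congr rfl fun m _ => ?_
  rw [chain_cons, ext_cons_succ K x m M n, ext_cons_succ K x m M 0, ext_zero]
  have e1 : ((K : ℚ) - M) / 2 + (M + ext x m M 1) / 2 = (K + ext x m M 1) / 2 := by ring
  have e2 : B + ((K : ℚ) - x) / 2 + (x + ext x m M n) / 2 = B + (K + ext x m M n) / 2 := by ring
  rw [e1, e2]
  ring

/-- After the induction hypothesis for the chain from x to M, the substitution x = l - M + 2j
reduces the claim, for fixed l and m, to `gauss_exchange`. The order M ≤ K serves to show that the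
cutoff x ≤ T loses nothing; the other order follows by reversing the chain. -/
lemma chainSum_succ_of_le (n : ℕ) (σ T : ℤ)
    (ih : ∀ (A B : ℚ) (K M : ℤ), 0 ≤ K → K ≤ T → 0 ≤ M → M ≤ T →
      chainSum n σ T A B K M = dualChainSum n σ T A B K M)
    (A B : ℚ) {K M : ℤ} (hK : K ≤ T) (hM : 0 ≤ M) (hMK : M ≤ K) :
    chainSum (n + 1) σ T A B K M = dualChainSum (n + 1) σ T A B K M := by
  have hMT := hMK.trans hK
  -- the summand on the left, after the inductive step
  let t : ℤ → ℤ → (Fin n → ℤ) → QSeries := fun x j m =>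
    edge σ K x * gauss (A + (M + x) / 2) K *
      (gauss ((K - M) / 2 + (B + (K - x) / 2) + j) j * (chain σ (x + M - 2 * j) m 0 *
        gauss ((K - M) / 2 + ext (x + M - 2 * j) m 0 1 / 2) (x - j) *
        gauss (B + (K - x) / 2 + ext (x + M - 2 * j) m 0 1 / 2) (M - j)))
  have hl : chainSum (n + 1) σ T A B K M =
      ∑ x ∈ Finset.Icc 0 T, ∑ j ∈ Finset.Icc 0 M, ∑ m ∈ box n (2 * T), t x j m := by
    rw [chainSum_succ]
    refine Finset.sum_congr rfl fun x hx => ?_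
    rw [Finset.mem_Icc] at hx
    rw [ih _ _ _ _ hx.1 hx.2 hM hMT, dualChainSum_eq_sum_Icc _ _ _ _ _ hMT, Finset.mul_sum]
    refine Finset.sum_congr rfl fun j _ => ?_
    rw [Finset.mul_sum, Finset.mul_sum]
  have hshift : ∀ j ∈ Finset.Icc 0 M, ∀ m, ∑ x ∈ Finset.Icc 0 T, t x j m =
      ∑ l ∈ Finset.Icc 0 (2 * T), t (l - M + 2 * j) j m := by
    intro j hj m
    rw [Finset.mem_Icc] at hj
    rw [sum_eq_sum_of_ne_zero (S' := (Finset.Icc 0 (2 * T)).map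
      (Equiv.addRight (2 * j - M)).toEmbedding), Finset.sum_map]
    · refine Finset.sum_congr rfl fun l _ => ?_
      congr 1
      simp only [Equiv.coe_toEmbedding, Equiv.coe_addRight]
      ring
    · intro x hx h0
      rw [Finset.mem_Icc] at hx
      have h1 := gauss_ne_zero_bot (right_ne_zero_of_mul
        (left_ne_zero_of_mul (right_ne_zero_of_mul (right_ne_zero_of_mul h0))))
      exact Finset.mem_map.2 ⟨x + M - 2 * j, Finset.mem_Icc.2 ⟨by omega, by omega⟩, by simp⟩
    · intro x hx h0
      obtain ⟨l, hl, rfl⟩ := Finset.mem_map.1 hx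
      simp only [Equiv.coe_toEmbedding, Equiv.coe_addRight] at h0 ⊢
      rw [Finset.mem_Icc] at hl
      have hedge := left_ne_zero_of_mul (left_ne_zero_of_mul h0)
      have hg := right_ne_zero_of_mul
        (left_ne_zero_of_mul (right_ne_zero_of_mul (right_ne_zero_of_mul h0)))
      have hc := left_ne_zero_of_mul
        (left_ne_zero_of_mul (right_ne_zero_of_mul (right_ne_zero_of_mul h0)))
      have e : l + (2 * j - M) + M - 2 * j = l := by ring
      rw [e] at hg hc
      have h1 := gauss_ne_zero_bot hg
      rw [Finset.mem_Icc]
      refine ⟨by omega, ?_⟩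
      -- The top entry (K - M + m_1)/2 is an integer by the parity of two edges, and nonnegative
      -- since M ≤ K. From m_1 ≤ l and K ≤ T < x it is smaller than the lower entry x - j, so the
      -- Gaussian factor vanishes.
      by_contra hT
      obtain ⟨u, hu⟩ := even_of_edge_ne_zero hedge
      obtain ⟨v, hv⟩ := ext_even_of_chain_ne_zero hc (j := 0) (Nat.zero_le _)
      rw [ext_zero, zero_add] at hv
      have h2 := ext_one_le_of_chain_ne_zero hc hl.1
      have h3 := ext_nonneg_of_chain_ne_zero hc hl.1 le_rfl 1
      have e' : ((K : ℚ) - M) / 2 + ext l m 0 1 / 2 = (u + l + j - M - v : ℤ) := by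
        have : K - M + ext l m 0 1 = 2 * (u + l + j - M - v) := by omega
        have : (K - M + ext l m 0 1 : ℚ) = 2 * (u + l + j - M - v : ℤ) := by exact_mod_cast this
        linarith
      rw [e'] at hg
      exact hg (gauss_eq_zero_of_lt (by omega) (by omega))
  have hr : dualChainSum (n + 1) σ T A B K M =
      ∑ l ∈ Finset.Icc 0 (2 * T), ∑ m ∈ box n (2 * T), ∑ j ∈ Finset.Icc 0 M,
        gauss (A + B + j) j * (edge σ (K + M - 2 * j) l *
          gauss ((K + M - 2 * j + ext l m 0 1) / 2) l * chain σ l m 0 *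
          gauss (A + l / 2) (K - j) * gauss (B + l / 2) (M - j)) := by
    rw [dualChainSum_eq_sum_Icc _ _ _ _ _ hMT]
    have : ∀ j ∈ Finset.Icc 0 M, gauss (A + B + j) j * ∑ m ∈ box (n + 1) (2 * T),
        chain σ (K + M - 2 * j) m 0 * gauss (A + ext (K + M - 2 * j) m 0 1 / 2) (K - j) *
          gauss (B + ext (K + M - 2 * j) m 0 1 / 2) (M - j) =
        ∑ l ∈ Finset.Icc 0 (2 * T), ∑ m ∈ box n (2 * T),
        gauss (A + B + j) j * (edge σ (K + M - 2 * j) l *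
          gauss ((K + M - 2 * j + ext l m 0 1) / 2) l * chain σ l m 0 *
          gauss (A + l / 2) (K - j) * gauss (B + l / 2) (M - j)) := by
      intro j _
      rw [sum_box_succ, Finset.mul_sum]
      refine Finset.sum_congr rfl fun l _ => ?_
      rw [Finset.mul_sum]
      refine Finset.sum_congr rfl fun m _ => ?_
      rw [chain_cons, ext_cons_succ _ l m 0 0, ext_zero]
      push_cast
      rfl
    rw [Finset.sum_congr rfl this, Finset.sum_comm]
    refine Finset.sum_congr rfl fun l _ => ?_
    rw [Finset.sum_comm]
  have hl' : chainSum (n + 1) σ T A B K M =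
      ∑ l ∈ Finset.Icc 0 (2 * T), ∑ m ∈ box n (2 * T), ∑ j ∈ Finset.Icc 0 M,
        t (l - M + 2 * j) j m := by
    rw [hl, Finset.sum_comm]
    have : ∀ j ∈ Finset.Icc 0 M, ∑ x ∈ Finset.Icc 0 T, ∑ m ∈ box n (2 * T), t x j m =
        ∑ l ∈ Finset.Icc 0 (2 * T), ∑ m ∈ box n (2 * T), t (l - M + 2 * j) j m := by
      intro j hj
      rw [Finset.sum_comm, Finset.sum_congr rfl fun m _ => hshift j hj m, Finset.sum_comm]
    rw [Finset.sum_congr rfl this, Finset.sum_comm]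
    refine Finset.sum_congr rfl fun l _ => ?_
    rw [Finset.sum_comm]
  rw [hl', hr]
  refine Finset.sum_congr rfl fun l _ => Finset.sum_congr rfl fun m _ => ?_
  have key := gauss_exchange A B K M l (ext l m 0 1)
  -- The parity of both j-dependent edges is independent of j and the same on the two sides, so
  -- either all edges carry their power of q or both sums vanish.
  by_cases hpar : Even (K - M - l - σ)
  · have e1 : ∀ j : ℤ, edge σ K (l - M + 2 * j) = qpow ((K - l + M - 2 * j) ^ 2 / 4) := by
      intro j
      rw [edge, if_pos]
      · congr 1; push_cast; ring
      · obtain ⟨z, hz⟩ := hpar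
        exact ⟨z + M - j, by omega⟩
    have e2 : ∀ j : ℤ, edge σ (K + M - 2 * j) l = qpow ((K + M - 2 * j - l) ^ 2 / 4) := by
      intro j
      rw [edge, if_pos]
      · congr 1; push_cast; ring
      · obtain ⟨z, hz⟩ := hpar
        exact ⟨z + M - j, by omega⟩
    have key' := congrArg (fun f => chain σ l m 0 * f) key
    simp only [Finset.mul_sum] at key'
    refine (Finset.sum_congr rfl fun j _ => ?_).trans
      (key'.trans (Finset.sum_congr rfl fun j _ => ?_))
    · simp only [t]
      have f1 : l - M + 2 * j + M - 2 * j = l := by ring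
      have f2 : A + ((M : ℚ) + (l - M + 2 * j : ℤ)) / 2 = A + l / 2 + j := by push_cast; ring
      have f3 : ((K : ℚ) - M) / 2 + (B + (K - (l - M + 2 * j : ℤ)) / 2) + j = B + K - l / 2 := by
        push_cast; ring
      have f4 : ((K : ℚ) - M) / 2 + ext l m 0 1 / 2 = (K - M + ext l m 0 1) / 2 := by ring
      have f5 : l - M + 2 * j - j = l - M + j := by ring
      have f6 : B + ((K : ℚ) - (l - M + 2 * j : ℤ)) / 2 + ext l m 0 1 / 2 =
          B + (K - l + M + ext l m 0 1) / 2 - j := by push_cast; ring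
      rw [f1, f2, f3, f4, f5, f6, e1]
      ring
    · have f1 : ((K : ℚ) + M - 2 * j + ext l m 0 1) / 2 = (K + M + ext l m 0 1) / 2 - j := by ring
      rw [e2, f1]
      ring
  · have e1 : ∀ j : ℤ, edge σ K (l - M + 2 * j) = 0 := by
      intro j
      refine if_neg fun ⟨z, hz⟩ => hpar ⟨z - M + j, by omega⟩
    have e2 : ∀ j : ℤ, edge σ (K + M - 2 * j) l = 0 := by
      intro j
      refine if_neg fun ⟨z, hz⟩ => hpar ⟨z - M + j, by omega⟩
    refine Finset.sum_congr rfl fun j _ => ?_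
    simp only [t]
    rw [e1, e2]
    ring

/-- The generalization of the `q`-Saalschütz sum, for Gaussian polynomials with arbitrary top
entries. -/
theorem chainSum_eq_dualChainSum (n : ℕ) (σ T : ℤ) : ∀ (A B : ℚ) (K M : ℤ), 0 ≤ K → K ≤ T →
    0 ≤ M → M ≤ T → chainSum n σ T A B K M = dualChainSum n σ T A B K M := by
  induction n with
  | zero => exact fun A B K M _ _ _ hM => chainSum_zero σ T A B hM
  | succ n ih =>
    intro A B K M hK hKT hM hMT
    rcases le_total M K with h | h
    · exact chainSum_succ_of_le n σ T ih A B hKT hM h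
    · rw [chainSum_comm, dualChainSum_comm]
      exact chainSum_succ_of_le n σ T ih B A hMT hK h

/-! ### Comparison of the truncated `qbin` with `gauss` -/

lemma qbin_symm (a b : ℚ) : qbin a b = qbin a (a - b) := by
  have h : (∃ k l : ℕ, b = k ∧ a - b = l) ↔ ∃ k l : ℕ, a - b = k ∧ a - (a - b) = l := by
    rw [sub_sub_cancel]
    exact ⟨fun ⟨k, l, hk, hl⟩ => ⟨l, k, hl, hk⟩, fun ⟨k, l, hk, hl⟩ => ⟨l, k, hl, hk⟩⟩
  by_cases h' : ∃ k l : ℕ, b = k ∧ a - b = l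
  · rw [qbin, qbin, if_pos h', if_pos (h.1 h'), sub_sub_cancel, mul_comm (qfac ⌊b⌋₊)]
  · rw [qbin, qbin, if_neg h', if_neg (mt h.2 h')]

lemma qbin_eq_zero {a b : ℚ} (h : b < 0 ∨ a < b) : qbin a b = 0 := by
  rw [qbin, if_neg]
  rintro ⟨k, l, hk, hl⟩
  have : (0 : ℚ) ≤ k := k.cast_nonneg
  have : (0 : ℚ) ≤ l := l.cast_nonneg
  rcases h with h | h <;> linarith

lemma qbin_ne_zero {a b : ℚ} (h : qbin a b ≠ 0) : 0 ≤ b ∧ b ≤ a := by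
  by_contra hc
  refine h (qbin_eq_zero ?_)
  by_contra! h'
  exact hc h'

lemma qbin_eq_gauss {a : ℤ} (ha : 0 ≤ a) (b : ℤ) : qbin a b = gauss a b := by
  rcases lt_or_ge b 0 with hb | hb
  · rw [gauss_of_neg _ hb, qbin_eq_zero (Or.inl (by exact_mod_cast hb))]
  rcases lt_or_ge a b with hb' | hb'
  · rw [gauss_eq_zero_of_lt ha hb', qbin_eq_zero (Or.inr (by exact_mod_cast hb'))]
  obtain ⟨b, rfl⟩ := Int.eq_ofNat_of_zero_le hb
  obtain ⟨c, rfl⟩ := Int.le.dest hb'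
  have h := gauss_natCast_add b c
  push_cast
  rw [h, qbin, if_pos ⟨b, c, rfl, by ring⟩]
  have e1 : ⌊(b : ℚ) + c⌋₊ = b + c := by
    rw [← Nat.cast_add, Nat.floor_natCast]
  have e2 : ⌊(b : ℚ) + c - b⌋₊ = c := by
    rw [add_sub_cancel_left, Nat.floor_natCast]
  rw [e1, e2, Nat.floor_natCast]

/-! ### The inverse Cartan matrix and the (m, n)-system as chains -/

/-- A rational vector, extended by zeros at both ends. -/
def zeroExt {n : ℕ} (v : Fin n → ℚ) : ℕ → ℚ
  | 0 => 0
  | j + 1 => if h : j < n then v ⟨j, h⟩ else 0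

lemma sum_ite_val_eq {n : ℕ} (v : Fin n → ℚ) (i : ℕ) :
    ∑ j : Fin n, (if j.val = i then v j else 0) = if h : i < n then v ⟨i, h⟩ else 0 := by
  by_cases h : i < n
  · rw [dif_pos h, Finset.sum_eq_single ⟨i, h⟩]
    · simp
    · intro j _ hj
      exact if_neg fun hji => hj (Fin.ext hji)
    · simp
  · rw [dif_neg h]
    exact Finset.sum_eq_zero fun j _ => if_neg fun hji => h (by have := j.2; omega)

lemma cartan_mulVec (n : ℕ) (v : Fin n → ℚ) (k : Fin n) :
    Matrix.mulVec (cartan (n + 1)) v k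
      = 2 * zeroExt v (k + 1) - zeroExt v k - zeroExt v (k + 2) := by
  have entry : ∀ j : Fin n, cartan (n + 1) k j * v j = 2 * (if j.val = k.val then v j else 0)
      - (if j.val + 1 = k.val then v j else 0) - (if j.val = k.val + 1 then v j else 0) := by
    intro j
    simp only [cartan, CartanMatrix.A, Matrix.map_apply, Matrix.of_apply, Fin.ext_iff]
    split_ifs <;> first | (exfalso; omega) | (push_cast; ring)
  have hk : ∑ j : Fin n, (if j.val + 1 = k.val then v j else 0) = zeroExt v k := by
    obtain ⟨k, hk⟩ := k
    cases k with
    | zero => simp [zeroExt]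
    | succ k =>
      simp only [add_left_inj]
      rw [sum_ite_val_eq, zeroExt]
  calc Matrix.mulVec (cartan (n + 1)) v k = ∑ j : Fin n, cartan (n + 1) k j * v j := rfl
    _ = _ := by
      rw [Finset.sum_congr rfl fun j _ => entry j, Finset.sum_sub_distrib,
        Finset.sum_sub_distrib, ← Finset.mul_sum, hk, sum_ite_val_eq, sum_ite_val_eq]
      rfl

/-- A kernel vector, extended by zeros, has vanishing second differences. So it and its negative are
convex with zero ends, and both are nonpositive. -/
lemma cartan_isUnit (n : ℕ) : IsUnit (cartan (n + 1)) := by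
  rw [← Matrix.mulVec_injective_iff_isUnit, ← Matrix.coe_mulVecLin, ← LinearMap.ker_eq_bot,
    LinearMap.ker_eq_bot']
  intro v hv
  have h : ∀ k < n, 2 * zeroExt v (k + 1) - zeroExt v k - zeroExt v (k + 2) = 0 := by
    intro k hk
    rw [← cartan_mulVec n v ⟨k, hk⟩]
    exact congrFun hv ⟨k, hk⟩
  have h0 : zeroExt v 0 = 0 := rfl
  have hn : zeroExt v (n + 1) = 0 := by simp [zeroExt]
  funext k
  have h1 := nonpos_of_convex (zeroExt v) n (fun k hk => by linarith [h k hk]) h0.le hn.le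
    (k + 1) (by have := k.2; omega)
  have h2 := nonpos_of_convex (fun j => -zeroExt v j) n (fun k hk => by linarith [h k hk])
    (by simp [h0]) (by simp [hn]) (k + 1) (by have := k.2; omega)
  have h3 : zeroExt v (k + 1) = v k := by simp only [zeroExt]; exact dif_pos k.2
  rw [h3] at h1
  simp only [h3] at h2
  change v k = 0
  linarith

/-- Computes C⁻¹η by exhibiting a preimage, so that no entry of the inverse matrix is needed. -/
lemma cinvMul_eq (n : ℕ) (η : Fin n → ℤ) (y : Fin n → ℚ)
    (h : ∀ k : Fin n, (η k : ℚ) = 2 * zeroExt y (k + 1) - zeroExt y k - zeroExt y (k + 2)) :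
    cinvMul (N := n + 1) η = y := by
  have : toRat (N := n + 1) η = Matrix.mulVec (cartan (n + 1)) y := by
    funext k
    rw [cartan_mulVec]
    exact h k
  rw [cinvMul, this, Matrix.mulVec_mulVec, Matrix.nonsing_inv_mul _
    ((Matrix.isUnit_iff_isUnit_det _).1 (cartan_isUnit n)), Matrix.one_mulVec]

lemma sum_by_parts (y : ℕ → ℚ) (n : ℕ) :
    ∑ k ∈ Finset.range n, (2 * y (k + 1) - y k - y (k + 2)) * y (k + 1)
      = ∑ j ∈ Finset.range (n + 1), (y (j + 1) - y j) ^ 2 + y 0 * (y 1 - y 0)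
        - y (n + 1) * (y (n + 1) - y n) := by
  induction n with
  | zero => simp; ring
  | succ n ih =>
    rw [Finset.sum_range_succ, ih, Finset.sum_range_succ _ (n + 1)]
    ring

/-- The system that couples `m` and `n`, written for the extended sequence. -/
lemma mn_system_iff (n : ℕ) (a b : ℤ) (m η : Fin n → ℤ) :
    (toRat (N := n + 1) m + toRat (N := n + 1) η = (1 / 2 : ℚ) •
      (Matrix.mulVec (incidence (n + 1)) (toRat (N := n + 1) m) + (a : ℚ) • eFirst (n + 1) +
        (b : ℚ) • eLast (n + 1))) ↔
    ∀ k : Fin n, 2 * η k = ext a m b k - 2 * ext a m b (k + 1) + ext a m b (k + 2) := by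
  have hinc : ∀ k : Fin n, ((1 / 2 : ℚ) •
      (Matrix.mulVec (incidence (n + 1)) (toRat (N := n + 1) m) + (a : ℚ) • eFirst (n + 1) +
        (b : ℚ) • eLast (n + 1))) k = (ext a m b k + ext a m b (k + 2)) / 2 := by
    intro k
    have h1 : Matrix.mulVec (incidence (n + 1)) (toRat (N := n + 1) m) k
        = 2 * (m k : ℚ) - Matrix.mulVec (cartan (n + 1)) (toRat (N := n + 1) m) k := by
      rw [incidence, Matrix.sub_mulVec, Matrix.smul_mulVec, Matrix.one_mulVec]
      rfl
    have h2 : zeroExt (toRat (N := n + 1) m) (k + 1) = m k := by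
      simp only [zeroExt]; exact dif_pos k.2
    have h3 : zeroExt (toRat (N := n + 1) m) k + a * eFirst (n + 1) k = ext a m b k := by
      obtain ⟨k, hk⟩ := k
      cases k with
      | zero => simp [zeroExt, eFirst, ext]
      | succ k => simp [zeroExt, eFirst, ext, toRat, Nat.lt_of_succ_lt hk]
    have h4 : zeroExt (toRat (N := n + 1) m) (k + 2) + b * eLast (n + 1) k
        = ext a m b (k + 2) := by
      obtain ⟨k, hk⟩ := k
      by_cases h : k + 1 < n
      · have : k + 1 ≠ n := h.ne
        simp [zeroExt, eLast, ext, toRat, h, this]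
      · have : k + 1 = n := by omega
        simp [zeroExt, eLast, ext, this]
    calc _ = (1 / 2 : ℚ) * (Matrix.mulVec (incidence (n + 1)) (toRat (N := n + 1) m) k +
          a * eFirst (n + 1) k + b * eLast (n + 1) k) := rfl
      _ = _ := by
        rw [h1, cartan_mulVec, h2, ← h3, ← h4]
        ring
  constructor
  · intro h k
    have := congrFun h k
    rw [hinc] at this
    have e : (m k : ℚ) + η k = (ext a m b k + ext a m b (k + 2)) / 2 := this
    have : (2 * η k : ℚ) = ext a m b k - 2 * m k + ext a m b (k + 2) := by linarith
    rw [ext_succ]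
    exact_mod_cast this
  · intro h
    funext k
    rw [hinc]
    have := h k
    rw [ext_succ] at this
    have : (2 * η k : ℚ) = ext a m b k - 2 * m k + ext a m b (k + 2) := by exact_mod_cast this
    change (m k : ℚ) + η k = _
    linarith

section pairs
variable {n : ℕ} {a b : ℤ} {m η : Fin n → ℤ}

/-- The deviation of the extended sequence from the line through its end points. -/
def deviation (a : ℤ) (m : Fin n → ℤ) (b : ℤ) (j : ℕ) : ℚ :=
  (a + ((b : ℚ) - a) * j / (n + 1) - ext a m b j) / 2

lemma zeroExt_deviation {j : ℕ} (hj : j ≤ n + 1) :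
    zeroExt (fun k : Fin n => deviation a m b (k + 1)) j = deviation a m b j := by
  have : (n : ℚ) + 1 ≠ 0 := by positivity
  cases j with
  | zero => simp [zeroExt, deviation, ext]
  | succ j =>
    by_cases h : j < n
    · simp [zeroExt, h]
    · obtain rfl : j = n := by omega
      simp only [zeroExt, deviation, ext, lt_irrefl, dite_false]
      push_cast
      field_simp
      ring

variable (h : ∀ k : Fin n, 2 * η k = ext a m b k - 2 * ext a m b (k + 1) + ext a m b (k + 2))
include h

lemma eta_eq_deviation (k : Fin n) : (η k : ℚ) = 2 * deviation a m b (k + 1)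
    - deviation a m b k - deviation a m b (k + 2) := by
  have : (2 * η k : ℚ) = ext a m b k - 2 * ext a m b (k + 1) + ext a m b (k + 2) := by
    exact_mod_cast h k
  simp only [deviation]
  push_cast
  ring_nf at this ⊢
  linarith

/-- 2η is the second difference of the chain. Subtracting the chain from its chord leaves second
differences unchanged up to sign and makes both end values zero, as `cinvMul_eq` requires. -/
lemma cinvMul_eq_deviation :
    cinvMul (N := n + 1) η = fun k : Fin n => deviation a m b (k + 1) := by
  refine cinvMul_eq n η _ fun k => ?_
  have := k.2
  rw [zeroExt_deviation (by omega), zeroExt_deviation (by omega), zeroExt_deviation (by omega),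
    eta_eq_deviation h]

/-- Summation by parts turns the quadratic form into the sum of squared increments of `deviation`.
The cross term with the slope of the chord telescopes and leaves the chord term. -/
lemma dotProduct_cinvMul :
    dotProduct (toRat (N := n + 1) η) (cinvMul (N := n + 1) η)
      = ∑ j ∈ Finset.range (n + 1), ((ext a m b j : ℚ) - ext a m b (j + 1)) ^ 2 / 4
        - ((a : ℚ) - b) ^ 2 / (4 * (n + 1)) := by
  have hn : (n : ℚ) + 1 ≠ 0 := by positivity
  have h0 : deviation a m b 0 = 0 := by simp [deviation, ext]
  have h1 : deviation a m b (n + 1) = 0 := by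
    rw [← zeroExt_deviation le_rfl]; simp [zeroExt]
  calc dotProduct (toRat (N := n + 1) η) (cinvMul (N := n + 1) η)
      = ∑ k : Fin n, (η k : ℚ) * deviation a m b (k + 1) := by
        rw [cinvMul_eq_deviation h]; rfl
    _ = ∑ k : Fin n, (2 * deviation a m b (k + 1) - deviation a m b k - deviation a m b (k + 2))
          * deviation a m b (k + 1) :=
        Finset.sum_congr rfl fun k _ => by rw [eta_eq_deviation h]
    _ = ∑ k ∈ Finset.range n, (2 * deviation a m b (k + 1) - deviation a m b k
          - deviation a m b (k + 2)) * deviation a m b (k + 1) :=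
        Fin.sum_univ_eq_sum_range (fun k => (2 * deviation a m b (k + 1) - deviation a m b k
          - deviation a m b (k + 2)) * deviation a m b (k + 1)) n
    _ = ∑ j ∈ Finset.range (n + 1), (deviation a m b (j + 1) - deviation a m b j) ^ 2 := by
        rw [sum_by_parts, h0, h1]; ring
    _ = ∑ j ∈ Finset.range (n + 1), (((ext a m b j : ℚ) - ext a m b (j + 1)) ^ 2 / 4
          + ((b : ℚ) - a) / (2 * (n + 1)) * ((ext a m b j : ℚ) - ext a m b (j + 1))
          + ((b : ℚ) - a) ^ 2 / (4 * (n + 1) ^ 2)) := by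
        refine Finset.sum_congr rfl fun j _ => ?_
        simp only [deviation]
        push_cast
        field_simp
        ring
    _ = _ := by
        rw [Finset.sum_add_distrib, Finset.sum_add_distrib, ← Finset.mul_sum,
          Finset.sum_range_sub' (fun j => (ext a m b j : ℚ)), Finset.sum_const, ext_zero,
          ext_last, Finset.card_range, nsmul_eq_mul]
        push_cast
        field_simp
        ring

end pairs

/-- For n = 0 the entry at index 1 is the right end b. This covers both conventions for N = 1: μ_1 =
b in the level-N polynomial, and m_1 = 0 in the dual sum, whose chains end at 0. -/
lemma firstComp_toRat {n : ℕ} (a b : ℤ) (m : Fin n → ℤ) (d : ℚ) (hd : d = b) :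
    firstComp (N := n + 1) (toRat (N := n + 1) m) d = ext a m b 1 := by
  subst hd
  by_cases h : 0 < n
  · have h' : 0 < n + 1 - 1 := h
    rw [firstComp, dif_pos h']
    simp only [ext, h, dite_true]
    rfl
  · have h' : ¬ 0 < n + 1 - 1 := h
    rw [firstComp, dif_neg h']
    simp [ext, h]

lemma lastComp_toRat {n : ℕ} (a b : ℤ) (m : Fin n → ℤ) (d : ℚ) (hd : d = a) :
    lastComp (N := n + 1) (toRat (N := n + 1) m) d = ext a m b n := by
  subst hd
  cases n with
  | zero => simp [lastComp, ext]
  | succ n =>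
    have h' : 0 < n + 1 + 1 - 1 := Nat.succ_pos n
    rw [lastComp, dif_pos h']
    simp only [ext, lt_add_one, dite_true]
    rfl

/-- For this t the slope of the chord cancels and t + (C⁻¹η)_1 = (a - m_1 + σ)/2, so the restriction
is the parity condition on the first edge. -/
lemma mem_mnPairs_iff {n : ℕ} {σ : ℕ} {t : ℚ} {a b : ℤ}
    (ht : t = (a - b + σ * ((n : ℚ) + 1)) / (2 * (n + 1))) (m η : Fin n → ℤ) :
    (m, η) ∈ mnPairs (n + 1) t a b ↔
      (∀ k : Fin n, 2 * η k = ext a m b k - 2 * ext a m b (k + 1) + ext a m b (k + 2)) ∧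
      Even (a - ext a m b 1 - σ) := by
  have hn : (n : ℚ) + 1 ≠ 0 := by positivity
  refine Iff.trans (b := (∀ k : Fin n, 2 * η k = ext a m b k - 2 * ext a m b (k + 1) +
    ext a m b (k + 2)) ∧ ∃ z : ℤ, t + firstComp (N := n + 1) (cinvMul (N := n + 1) η) 0 = z)
    (and_congr_left' (mn_system_iff n a b m η)) ?_
  refine and_congr_right fun h => ?_
  have e : t + firstComp (N := n + 1) (cinvMul (N := n + 1) η) 0
      = ((a : ℚ) - ext a m b 1 + σ) / 2 := by
    by_cases h0 : 0 < n
    · have h' : 0 < n + 1 - 1 := h0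
      rw [firstComp, dif_pos h', cinvMul_eq_deviation h]
      simp only [deviation, ht]
      push_cast
      field_simp
      ring
    · have h' : ¬ 0 < n + 1 - 1 := h0
      obtain rfl : n = 0 := by omega
      rw [firstComp, dif_neg h', ht]
      simp [ext]
  rw [e]
  constructor
  · rintro ⟨z, hz⟩
    have : (a : ℚ) - ext a m b 1 + σ = 2 * z := by linarith
    have : a - ext a m b 1 + σ = 2 * z := by exact_mod_cast this
    exact ⟨z - σ, by omega⟩
  · rintro ⟨z, hz⟩
    refine ⟨z + σ, ?_⟩
    have : a - ext a m b 1 + σ = 2 * (z + σ) := by omega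
    have : (a : ℚ) - ext a m b 1 + σ = 2 * (z + σ) := by exact_mod_cast this
    push_cast
    linarith

lemma qpow_sum {ι : Type*} (s : Finset ι) (f : ι → ℚ) :
    qpow (∑ i ∈ s, f i) = ∏ i ∈ s, qpow (f i) := by
  classical
  induction s using Finset.induction_on with
  | empty => simp [qpow_zero]
  | insert i s hi ih => rw [Finset.sum_insert hi, Finset.prod_insert hi, qpow_add, ih]

section pairs
variable {n : ℕ} {a b : ℤ} {m η : Fin n → ℤ}
  (h : ∀ k : Fin n, 2 * η k = ext a m b k - 2 * ext a m b (k + 1) + ext a m b (k + 2))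
include h

/-- Second differences equal the even numbers 2η_k, so the parity of the first edge propagates along
the chain. -/
lemma ext_even_of_pair {σ : ℤ} (h0 : Even (a - ext a m b 1 - σ)) {j : ℕ} (hj : j ≤ n) :
    Even (ext a m b j - ext a m b (j + 1) - σ) := by
  induction j with
  | zero => exact h0
  | succ j ih =>
    obtain ⟨z, hz⟩ := ih (by omega)
    have := h ⟨j, by omega⟩
    simp only at this
    exact ⟨z - η ⟨j, by omega⟩, by rw [show j + 1 + 1 = j + 2 by ring]; omega⟩

lemma weight_eq_chain {σ : ℤ} (h0 : Even (a - ext a m b 1 - σ)) (ha : 0 ≤ a) (hb : 0 ≤ b)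
    (hm : ∀ k, 0 ≤ m k) : weight (N := n + 1) (m, η)
      = qpow (-(((a : ℚ) - b) ^ 2 / (4 * (n + 1)))) * chain σ a m b := by
  have h1 : ∏ j ∈ Finset.range (n + 1), edge σ (ext a m b j) (ext a m b (j + 1)) =
      qpow (∑ j ∈ Finset.range (n + 1), ((ext a m b j : ℚ) - ext a m b (j + 1)) ^ 2 / 4) := by
    rw [qpow_sum]
    refine Finset.prod_congr rfl fun j hj => ?_
    exact if_pos (ext_even_of_pair h h0 (Nat.lt_succ_iff.1 (Finset.mem_range.1 hj)))
  have h2 : ∏ k : Fin n, qbin ((m k : ℚ) + η k) (η k) = ∏ j ∈ Finset.range n,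
      gauss ((ext a m b j + ext a m b (j + 2)) / 2) (ext a m b (j + 1)) := by
    rw [← Fin.prod_univ_eq_prod_range (fun j =>
      gauss (((ext a m b j : ℚ) + ext a m b (j + 2)) / 2) (ext a m b (j + 1))) n]
    refine Finset.prod_congr rfl fun k _ => ?_
    have hk := h k
    rw [ext_succ] at hk ⊢
    have e : ((ext a m b k : ℚ) + ext a m b (k + 2)) / 2 = (m k + η k : ℤ) := by
      have : (2 * η k : ℚ) = ext a m b k - 2 * m k + ext a m b (k + 2) := by exact_mod_cast hk
      push_cast
      linarith
    have := ext_nonneg hm ha hb k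
    have := ext_nonneg hm ha hb (k + 2)
    rw [qbin_symm, e, ← qbin_eq_gauss (by omega)]
    push_cast
    congr 1
    ring
  calc weight (N := n + 1) (m, η) = qpow (dotProduct (toRat (N := n + 1) η)
        (cinvMul (N := n + 1) η)) * ∏ k : Fin n, qbin ((m k : ℚ) + η k) (η k) := rfl
    _ = _ := by
      rw [dotProduct_cinvMul h, h2, chain, h1, ← mul_assoc, ← qpow_add]
      congr 2
      ring

/-- A nonzero weight forces m ≥ 0 and η ≥ 0; the latter makes the chain convex, hence bounded by its
ends. -/
lemma mem_box_of_weight_ne_zero (hw : weight (N := n + 1) (m, η) ≠ 0) {T : ℤ} (ha : a ≤ T)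
    (hb : b ≤ T) : m ∈ box n T := by
  have hq : ∀ k : Fin n, 0 ≤ (η k : ℚ) ∧ (η k : ℚ) ≤ (m k : ℚ) + η k := fun k =>
    qbin_ne_zero (Finset.prod_ne_zero_iff.1 (right_ne_zero_of_mul hw) k (Finset.mem_univ _))
  have haT : (a : ℚ) ≤ T := by exact_mod_cast ha
  have hbT : (b : ℚ) ≤ T := by exact_mod_cast hb
  have := nonpos_of_convex (fun j => (ext a m b j : ℚ) - T) n (fun k hk => by
    have h1 := h ⟨k, hk⟩
    have h2 := (hq ⟨k, hk⟩).1
    have : (2 * η ⟨k, hk⟩ : ℚ) = ext a m b k - 2 * ext a m b (k + 1) + ext a m b (k + 2) := by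
      exact_mod_cast h1
    linarith) (by rw [ext_zero]; linarith) (by rw [ext_last]; linarith)
  rw [mem_box]
  intro k
  have h1 := this (k + 1) (by have := k.2; omega)
  have h2 := (hq k).2
  simp only [ext_succ] at h1
  constructor
  · have : (0 : ℚ) ≤ m k := by linarith
    exact_mod_cast this
  · have : (m k : ℚ) ≤ T := by linarith
    exact_mod_cast this

end pairs

section sums
variable {n : ℕ} {σ : ℕ} {t : ℚ} {a b : ℤ}
  (ht : t = (a - b + σ * ((n : ℚ) + 1)) / (2 * (n + 1)))
include ht

lemma finite_mnPairs_inter_support :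
    (mnPairs (n + 1) t a b ∩ Function.support weight).Finite := by
  refine Set.Finite.of_injOn (f := Prod.fst) (t := (box n (max a b) : Set (Fin n → ℤ))) ?_ ?_
    (Finset.finite_toSet _)
  · rintro ⟨m, η⟩ ⟨hx, hw⟩
    exact mem_box_of_weight_ne_zero ((mem_mnPairs_iff ht m η).1 hx).1 hw (le_max_left _ _)
      (le_max_right _ _)
  · rintro ⟨m, η⟩ ⟨hx, _⟩ ⟨m', η'⟩ ⟨hx', _⟩ hm
    obtain rfl : m = m' := hm
    have h1 := ((mem_mnPairs_iff ht m η).1 hx).1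
    have h2 := ((mem_mnPairs_iff ht m η').1 hx').1
    have : η = η' := by
      funext k
      have := h1 k
      have := h2 k
      omega
    rw [this]

lemma finsum_mnPairs (ha : 0 ≤ a) (hb : 0 ≤ b) {T : ℤ} (haT : a ≤ T) (hbT : b ≤ T)
    (F : (Fin n → ℤ) → QSeries) :
    ∑ᶠ x ∈ mnPairs (n + 1) t a b, weight x * F x.1 =
      qpow (-(((a : ℚ) - b) ^ 2 / (4 * (n + 1)))) * ∑ m ∈ box n T, chain σ a m b * F m := by
  classical
  -- Recovers η from m. The integer division is exact whenever the chain weight is nonzero.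
  let g : (Fin n → ℤ) → (Fin n → ℤ) × (Fin n → ℤ) := fun m =>
    (m, fun k => (ext a m b k - 2 * ext a m b (k + 1) + ext a m b (k + 2)) / 2)
  have hg : Function.Injective g := fun m m' h => congrArg Prod.fst h
  have hpair : ∀ m, chain σ a m b ≠ 0 → ∀ k : Fin n, 2 * (g m).2 k =
      ext a m b k - 2 * ext a m b (k + 1) + ext a m b (k + 2) := by
    intro m hm k
    obtain ⟨z, hz⟩ := exists_half_of_chain_ne_zero hm k.2
    simp only [g]
    omega
  have hval : ∀ m ∈ box n T, chain σ a m b ≠ 0 → weight (N := n + 1) (g m) =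
      qpow (-(((a : ℚ) - b) ^ 2 / (4 * (n + 1)))) * chain σ a m b := by
    intro m hm hc
    exact weight_eq_chain (hpair m hc) (ext_even_of_chain_ne_zero hc (Nat.zero_le _)) ha hb
      fun k => (mem_box.1 hm k).1
  refine (finsum_mem_eq_sum_of_inter_support_eq (fun x => weight (N := n + 1) x * F x.1)
    (t := ((box n T).filter fun m => chain σ a m b ≠ 0).image g) ?_).trans ?_
  · ext ⟨m, η⟩
    refine and_congr_left fun hs => ?_
    have hw := left_ne_zero_of_mul hs
    rw [mem_mnPairs_iff ht, Finset.mem_coe, Finset.mem_image]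
    constructor
    · rintro ⟨h1, h2⟩
      have hb' := mem_box_of_weight_ne_zero h1 hw haT hbT
      rw [weight_eq_chain h1 h2 ha hb fun k => (mem_box.1 hb' k).1] at hw
      have hc := right_ne_zero_of_mul hw
      refine ⟨m, Finset.mem_filter.2 ⟨hb', hc⟩, ?_⟩
      have : (g m).2 = η := by
        funext k
        have := hpair m hc k
        have := h1 k
        omega
      exact Prod.ext rfl this
    · rintro ⟨m', hm', he⟩
      obtain rfl : m' = m := congrArg Prod.fst he
      obtain rfl : (g m').2 = η := congrArg Prod.snd he
      have hc := (Finset.mem_filter.1 hm').2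
      exact ⟨hpair m' hc, ext_even_of_chain_ne_zero hc (Nat.zero_le _)⟩
  · refine (Finset.sum_image hg.injOn).trans ?_
    rw [Finset.mul_sum]
    refine Eq.trans ?_ (Finset.sum_filter_of_ne (p := fun m => chain σ a m b ≠ 0) ?_)
    · refine Finset.sum_congr rfl fun m hm => ?_
      obtain ⟨h1, h2⟩ := Finset.mem_filter.1 hm
      rw [hval m h1 h2, mul_assoc]
    · intro m _ hm
      exact left_ne_zero_of_mul (right_ne_zero_of_mul hm)

end sums

/-! ### The generalized q-Saalschütz sum for `qbin` -/

/-- The condition on the parameters under which the generalized `q`-Saalschütz sum holds for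
Gaussian polynomials that vanish when the top entry is negative. -/
def Admissible (N A B l : ℚ) : Prop :=
  l * (1 + 1 / N) ≤ A → -(l * (1 + 1 / N)) ≤ B →
    (l < 0 → 0 ≤ A ∨ B + l ≤ A - l) ∧ (0 < l → 0 ≤ B ∨ A - l ≤ B + l)

lemma Admissible.symm {N A B l : ℚ} (h : Admissible N A B l) : Admissible N B A (-l) := by
  intro h1 h2
  obtain ⟨h3, h4⟩ := h (by linarith) (by linarith)
  refine ⟨fun hl => ?_, fun hl => ?_⟩
  · rcases h4 (by linarith) with h | h
    · exact Or.inl h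
    · exact Or.inr (by linarith)
  · rcases h3 (by linarith) with h | h
    · exact Or.inl h
    · exact Or.inr (by linarith)

lemma innerSum_eq_sum_box {n σ : ℕ} {t : ℚ} {a b : ℤ}
    (ht : t = (a - b + σ * ((n : ℚ) + 1)) / (2 * (n + 1))) (ha : 0 ≤ a) (hb : 0 ≤ b) {T : ℤ}
    (haT : a ≤ T) (hbT : b ≤ T) (u v : ℚ) :
    innerSum (n + 1) t a b u v = qpow (-(((a : ℚ) - b) ^ 2 / (4 * (n + 1)))) *
      ∑ m ∈ box n T, chain σ a m b * (qbin (u - (b - ext a m b 1) / 2) a *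
        qbin (v - (a - ext a m b n) / 2) b) := by
  rw [← finsum_mnPairs ht ha hb haT hbT, innerSum]
  refine finsum_mem_congr rfl fun x _ => ?_
  rw [innerTerm, mul_assoc]
  congr 2
  · rw [firstComp_toRat (n := n) a b x.1 b rfl]
  · rw [lastComp_toRat (n := n) a b x.1 a rfl]

lemma innerSum_eq_zero {N : ℕ} {t a b u v : ℚ} (h : a < 0 ∨ b < 0) :
    innerSum N t a b u v = 0 := by
  rw [innerSum]
  refine finsum_mem_eq_zero_of_forall_eq_zero fun x _ => ?_
  rw [innerTerm]
  rcases h with h | h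
  · rw [qbin_eq_zero (b := a) (Or.inl h), mul_zero, zero_mul]
  · rw [qbin_eq_zero (b := b) (Or.inl h), mul_zero]

section bounds
variable {n : ℕ} {σ : ℤ} {A B l : ℚ}

/-- The lower entries K and M cannot exceed their top entries, where m_1 and m_n lie below the
chord. Outside these bounds the sum is zero, so `Admissible` may take them as premises. -/
lemma bounds_of_chain_term_ne_zero {K M : ℤ} {m : Fin n → ℤ} (hl : l = ((K : ℚ) - M) / 2)
    (hK : 0 ≤ K) (hM : 0 ≤ M)
    (h : chain σ K m M * (qbin (A + (M + ext K m M 1) / 2) K *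
      qbin (B + (K + ext K m M n) / 2) M) ≠ 0) :
    l * (1 + 1 / (n + 1)) ≤ A ∧ -(l * (1 + 1 / (n + 1))) ≤ B := by
  have hc := left_ne_zero_of_mul h
  have h1 := (qbin_ne_zero (left_ne_zero_of_mul (right_ne_zero_of_mul h))).2
  have h2 := (qbin_ne_zero (right_ne_zero_of_mul (right_ne_zero_of_mul h))).2
  have h3 := ext_le_line_of_chain_ne_zero hc hK hM (j := 1) (by omega)
  have h4 := ext_le_line_of_chain_ne_zero hc hK hM (j := n) (by omega)
  have hn : (n : ℚ) + 1 ≠ 0 := by positivity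
  have e1 : (K : ℚ) + ((M : ℚ) - K) * (1 : ℕ) / (n + 1) = K - 2 * (l * (1 / (n + 1))) := by
    rw [hl]; push_cast; field_simp; ring
  have e2 : (K : ℚ) + ((M : ℚ) - K) * n / (n + 1) = M + 2 * (l * (1 / (n + 1))) := by
    rw [hl]; field_simp; ring
  rw [e1] at h3
  rw [e2] at h4
  rw [mul_add, mul_one]
  constructor <;> linarith

/-- Here the chord runs from d = K + M - 2j to 0, so m_1 ≤ d(1 - 1/(n+1)), while nonnegative lower
entries give d ≥ 2|l|. The bounds agree with those for the original sum, so both sides vanish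
together. -/
lemma bounds_of_dual_term_ne_zero {K M j : ℤ} {m : Fin n → ℤ} (hl : l = ((K : ℚ) - M) / 2)
    (h : chain σ (K + M - 2 * j) m 0 * (qbin (A + ext (K + M - 2 * j) m 0 1 / 2) (K - j) *
      qbin (B + ext (K + M - 2 * j) m 0 1 / 2) (M - j)) ≠ 0) :
    l * (1 + 1 / (n + 1)) ≤ A ∧ -(l * (1 + 1 / (n + 1))) ≤ B := by
  have hc := left_ne_zero_of_mul h
  obtain ⟨h1, h1'⟩ := qbin_ne_zero (left_ne_zero_of_mul (right_ne_zero_of_mul h))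
  obtain ⟨h2, h2'⟩ := qbin_ne_zero (right_ne_zero_of_mul (right_ne_zero_of_mul h))
  have hd : 0 ≤ K + M - 2 * j := by
    have : (0 : ℚ) ≤ (K + M - 2 * j : ℤ) := by push_cast; linarith
    exact_mod_cast this
  have h3 := ext_le_line_of_chain_ne_zero hc hd le_rfl (j := 1) (by omega)
  have hn : (0 : ℚ) < 1 / ((n : ℚ) + 1) := by positivity
  have e1 : ((K + M - 2 * j : ℤ) : ℚ) + (((0 : ℤ) : ℚ) - (K + M - 2 * j : ℤ)) * (1 : ℕ) / (n + 1)
      = (K + M - 2 * j) - (K + M - 2 * j) * (1 / (n + 1)) := by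
    push_cast; ring
  rw [e1] at h3
  have h4 : 2 * l * (1 / ((n : ℚ) + 1)) ≤ (K + M - 2 * j) * (1 / (n + 1)) :=
    mul_le_mul_of_nonneg_right (by linarith) hn.le
  have h5 : -(2 * l) * (1 / ((n : ℚ) + 1)) ≤ (K + M - 2 * j) * (1 / (n + 1)) :=
    mul_le_mul_of_nonneg_right (by linarith) hn.le
  rw [mul_add, mul_one]
  constructor <;> linarith

end bounds

lemma qbin_eq_gauss' {x : ℚ} (hx : 0 ≤ x) (hz : ∃ z : ℤ, x = z) (b : ℤ) :
    qbin x b = gauss x b := by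
  obtain ⟨z, rfl⟩ := hz
  exact qbin_eq_gauss (by exact_mod_cast hx) b

/-- One nonnegative top entry can suffice: if its `qbin` is zero both products vanish; otherwise it
dominates its lower entry, and the linear inequality makes the other top entry nonnegative as well.
-/
lemma qbin_mul_qbin_eq_gauss {x y : ℚ} (hx : ∃ z : ℤ, x = z) (hy : ∃ z : ℤ, y = z) {a b : ℤ}
    (h : (0 ≤ x ∧ 0 ≤ y) ∨ (0 ≤ y ∧ y + (a - b) ≤ x) ∨ (0 ≤ x ∧ x + (b - a) ≤ y)) :
    qbin x a * qbin y b = gauss x a * gauss y b := by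
  rcases lt_or_ge a 0 with ha | ha
  · rw [gauss_of_neg _ ha, qbin_eq_zero (b := a) (Or.inl (by exact_mod_cast ha)), zero_mul,
      zero_mul]
  rcases lt_or_ge b 0 with hb | hb
  · rw [gauss_of_neg _ hb, qbin_eq_zero (b := b) (Or.inl (by exact_mod_cast hb)), mul_zero,
      mul_zero]
  have ha' : (0 : ℚ) ≤ a := by exact_mod_cast ha
  have hb' : (0 : ℚ) ≤ b := by exact_mod_cast hb
  rcases h with ⟨h1, h2⟩ | ⟨h1, h2⟩ | ⟨h1, h2⟩
  · rw [qbin_eq_gauss' h1 hx, qbin_eq_gauss' h2 hy]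
  · rw [← qbin_eq_gauss' h1 hy]
    by_cases h0 : qbin y b = 0
    · rw [h0, mul_zero, mul_zero]
    · rw [qbin_eq_gauss' _ hx]
      have := (qbin_ne_zero h0).2
      linarith
  · rw [← qbin_eq_gauss' h1 hx]
    by_cases h0 : qbin x a = 0
    · rw [h0, zero_mul, zero_mul]
    · rw [qbin_eq_gauss' _ hy]
      have := (qbin_ne_zero h0).2
      linarith

/-- The generalization of the `q`-Saalschütz sum. -/
theorem innerSum_eq_dual {n σ : ℕ} {t A B : ℚ} {K M : ℤ} {T : ℤ} (hKT : K ≤ T) (hMT : M ≤ T)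
    (ht : t = (K - M + σ * ((n : ℚ) + 1)) / (2 * (n + 1)))
    (hA : ∃ z : ℤ, A = z + ((K : ℚ) - M - σ) / 2) (hB : ∃ z : ℤ, B = z - ((K : ℚ) - M + σ) / 2)
    (hadm : Admissible (n + 1) A B (((K : ℚ) - M) / 2)) :
    innerSum (n + 1) t K M (A + M) (B + K) = qpow (-(((K : ℚ) - M) ^ 2 / (4 * (n + 1)))) *
      ∑ j ∈ Finset.Icc 0 T, qbin (A + B + j) j * ∑ m ∈ box n (2 * T),
        chain σ (K + M - 2 * j) m 0 * (qbin (A + ext (K + M - 2 * j) m 0 1 / 2) (K - j) *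
          qbin (B + ext (K + M - 2 * j) m 0 1 / 2) (M - j)) := by
  by_cases hneg : K < 0 ∨ M < 0
  · rw [innerSum_eq_zero (by exact_mod_cast hneg), Finset.sum_eq_zero, mul_zero]
    intro j hj
    rw [Finset.mem_Icc] at hj
    rw [Finset.sum_eq_zero, mul_zero]
    intro m _
    have hj0 : (0 : ℚ) ≤ j := by exact_mod_cast hj.1
    rcases hneg with h | h
    · have h' : (K : ℚ) < 0 := by exact_mod_cast h
      rw [qbin_eq_zero (b := (K : ℚ) - j) (Or.inl (by linarith)), zero_mul, mul_zero]
    · have h' : (M : ℚ) < 0 := by exact_mod_cast h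
      rw [qbin_eq_zero (b := (M : ℚ) - j) (Or.inl (by linarith)), mul_zero, mul_zero]
  rw [not_or, not_lt, not_lt] at hneg
  obtain ⟨hK, hM⟩ := hneg
  have hK' : (0 : ℚ) ≤ K := by exact_mod_cast hK
  have hM' : (0 : ℚ) ≤ M := by exact_mod_cast hM
  rw [innerSum_eq_sum_box ht hK hM hKT hMT]
  congr 1
  have etop : ∀ m ∈ box n T, chain σ K m M *
      (qbin (A + M - (M - ext K m M 1) / 2) K * qbin (B + K - (K - ext K m M n) / 2) M)
      = chain σ K m M *
      (qbin (A + (M + ext K m M 1) / 2) K * qbin (B + (K + ext K m M n) / 2) M) := by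
    intro m _
    congr 3 <;> ring
  rw [Finset.sum_congr rfl etop]
  obtain ⟨l, hl⟩ : ∃ l, l = ((K : ℚ) - M) / 2 := ⟨_, rfl⟩
  rw [← hl] at hadm
  -- If a bound fails, every term on either side is zero; if both hold, `Admissible` supplies the
  -- signs for replacing `qbin` by `gauss`.
  by_cases hb : l * (1 + 1 / ((n : ℚ) + 1)) ≤ A ∧ -(l * (1 + 1 / ((n : ℚ) + 1))) ≤ B
  swap
  · rw [Finset.sum_eq_zero, Finset.sum_eq_zero]
    · intro j _
      rw [Finset.sum_eq_zero, mul_zero]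
      intro m _
      by_contra h
      exact hb (bounds_of_dual_term_ne_zero hl h)
    · intro m _
      by_contra h
      exact hb (bounds_of_chain_term_ne_zero hl hK hM h)
  obtain ⟨hbA, hbB⟩ := hb
  obtain ⟨hneg, hpos⟩ := hadm hbA hbB
  obtain ⟨c, hc⟩ : ∃ c, c = l * (1 / ((n : ℚ) + 1)) := ⟨_, rfl⟩
  have hn : (0 : ℚ) < 1 / ((n : ℚ) + 1) := by positivity
  have hc0 : 0 ≤ l → 0 ≤ c := fun h => hc ▸ mul_nonneg h hn.le
  have hc1 : l ≤ 0 → c ≤ 0 := fun h => hc ▸ mul_nonpos_of_nonpos_of_nonneg h hn.le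
  rw [mul_add, mul_one, ← hc] at hbA hbB
  -- the possible signs of the parameters
  have hcases : (0 ≤ A ∧ 0 ≤ B) ∨ (l < 0 ∧ 0 ≤ B ∧ B + l ≤ A - l ∧ 0 ≤ A - l) ∨
      (0 < l ∧ 0 ≤ A ∧ A - l ≤ B + l ∧ 0 ≤ B + l) := by
    rcases lt_trichotomy l 0 with h | h | h
    · have := hc1 h.le
      rcases hneg h with h' | h'
      · exact Or.inl ⟨h', by linarith⟩
      · exact Or.inr (Or.inl ⟨h, by linarith, h', by linarith⟩)
    · have := hc1 h.le
      have := hc0 h.ge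
      exact Or.inl ⟨by linarith, by linarith⟩
    · have := hc0 h.le
      rcases hpos h with h' | h'
      · exact Or.inl ⟨by linarith, h'⟩
      · exact Or.inr (Or.inr ⟨h, by linarith, h', by linarith⟩)
  obtain ⟨zA, hzA⟩ := hA
  obtain ⟨zB, hzB⟩ := hB
  have main := chainSum_eq_dualChainSum n σ T A B K M hK hKT hM hMT
  rw [chainSum, dualChainSum] at main
  refine Eq.trans ?_ (main.trans ?_)
  · refine Finset.sum_congr rfl fun m _ => ?_
    by_cases h0 : chain σ K m M = 0
    · rw [h0]; ring
    obtain ⟨z1, hz1⟩ := ext_even_of_chain_ne_zero h0 (j := 0) (Nat.zero_le _)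
    obtain ⟨z2, hz2⟩ := ext_even_of_chain_ne_zero h0 (j := n) le_rfl
    rw [ext_zero, zero_add] at hz1
    rw [ext_last] at hz2
    have hz1' : (K : ℚ) - ext K m M 1 - σ = z1 + z1 := by exact_mod_cast hz1
    have hz2' : (ext K m M n : ℚ) - M - σ = z2 + z2 := by exact_mod_cast hz2
    have h1 : (0 : ℚ) ≤ ext K m M 1 := by
      exact_mod_cast ext_nonneg_of_chain_ne_zero h0 hK hM 1
    have h2 : (0 : ℚ) ≤ ext K m M n := by
      exact_mod_cast ext_nonneg_of_chain_ne_zero h0 hK hM n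
    rw [qbin_eq_gauss' _ ⟨zA + z1 + ext K m M 1, by push_cast; linarith⟩,
      qbin_eq_gauss' _ ⟨zB + z2 + M, by push_cast; linarith⟩, mul_assoc]
    · rcases hcases with h | h | h <;> linarith [h.1, h.2]
    · rcases hcases with h | h | h <;> linarith [h.1, h.2]
  · refine Finset.sum_congr rfl fun j hj => ?_
    rw [Finset.mem_Icc] at hj
    have hj0 : (0 : ℚ) ≤ j := by exact_mod_cast hj.1
    rw [qbin_eq_gauss' (x := A + B + j) _ ⟨zA + zB - σ + j, by push_cast; linarith⟩]
    · refine congrArg _ (Finset.sum_congr rfl fun m _ => ?_)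
      by_cases h0 : chain σ (K + M - 2 * j) m 0 = 0
      · rw [h0]; ring
      rw [mul_assoc]
      refine congrArg _ ?_
      by_cases hd : K + M - 2 * j < 0
      · rcases lt_or_ge (K - j) 0 with h | h
        · have h' : (K : ℚ) - j < 0 := by exact_mod_cast h
          rw [gauss_of_neg _ h, qbin_eq_zero (b := (K : ℚ) - j) (Or.inl h'), zero_mul, zero_mul]
        · have h : M - j < 0 := by omega
          have h' : (M : ℚ) - j < 0 := by exact_mod_cast h
          rw [gauss_of_neg _ h, qbin_eq_zero (b := (M : ℚ) - j) (Or.inl h'), mul_zero, mul_zero]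
      obtain ⟨z1, hz1⟩ := ext_even_of_chain_ne_zero h0 (j := 0) (Nat.zero_le _)
      rw [ext_zero, zero_add] at hz1
      have hz1' : (K + M - 2 * j : ℚ) - ext (K + M - 2 * j) m 0 1 - σ = z1 + z1 := by
        exact_mod_cast hz1
      have h1 : (0 : ℚ) ≤ ext (K + M - 2 * j) m 0 1 := by
        exact_mod_cast ext_nonneg_of_chain_ne_zero h0 (not_lt.1 hd) le_rfl 1
      have := qbin_mul_qbin_eq_gauss (x := A + ext (K + M - 2 * j) m 0 1 / 2)
        (y := B + ext (K + M - 2 * j) m 0 1 / 2) (a := K - j) (b := M - j)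
        ⟨zA - M + j + z1 + ext (K + M - 2 * j) m 0 1, by push_cast; linarith⟩
        ⟨zB - K + j + z1 + ext (K + M - 2 * j) m 0 1, by push_cast; linarith⟩ (by
          push_cast
          rcases hcases with h | h | h
          · exact Or.inl ⟨by linarith [h.1], by linarith [h.2]⟩
          · exact Or.inr (Or.inl ⟨by linarith [h.2.1], by linarith [h.2.2.1]⟩)
          · exact Or.inr (Or.inr ⟨by linarith [h.2.1], by linarith [h.2.2.1]⟩))
      rw [← this]
      push_cast
      rfl
    · rcases hcases with h | h | h <;> linarith [h.1, h.2]

lemma bounds_of_mul_bounds {k j c : ℤ} (hk : 1 ≤ k) (h1 : -c ≤ k * j) (h2 : k * j ≤ c) :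
    -c ≤ j ∧ j ≤ c := by
  constructor
  · by_contra h
    nlinarith
  · by_contra h
    nlinarith

lemma weight_ne_zero_of_innerTerm {N : ℕ} {a b u v : ℚ}
    {x : (Fin (N - 1) → ℤ) × (Fin (N - 1) → ℤ)} (h : innerTerm a b u v x ≠ 0) : weight x ≠ 0 :=
  left_ne_zero_of_mul (left_ne_zero_of_mul h)

lemma finite_innerTerm {n σ : ℕ} {t a b : ℚ} (u v : ℚ) (ha : ∃ z : ℤ, a = z)
    (hb : ∃ z : ℤ, b = z) (ht : t = (a - b + σ * ((n + 1 : ℕ) : ℚ)) / (2 * ((n + 1 : ℕ) : ℚ))) :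
    (mnPairs (n + 1) t a b ∩ Function.support (innerTerm a b u v)).Finite := by
  obtain ⟨a, rfl⟩ := ha
  obtain ⟨b, rfl⟩ := hb
  push_cast at ht
  exact (finite_mnPairs_inter_support ht).subset
    (Set.inter_subset_inter_right _ fun x hx => weight_ne_zero_of_innerTerm hx)

/-- The generalized `q`-Saalschütz sum in the form in which it is used in the transform. -/
lemma innerSum_eq_dual_shift {n σ : ℕ} {t a b u v A B : ℚ} {Q c₁ c₂ d T : ℤ}
    (hd : c₁ + c₂ = d) (ha : a = Q + c₁) (hb : b = Q + c₂) (hu : u = A + b) (hv : v = B + a)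
    (ht : t = (a - b + σ * ((n + 1 : ℕ) : ℚ)) / (2 * ((n + 1 : ℕ) : ℚ)))
    (h1 : Q + c₁ ≤ T) (h2 : Q + c₂ ≤ T)
    (hA : ∃ z : ℤ, A = z + ((c₁ : ℚ) - c₂ - σ) / 2) (hB : ∃ z : ℤ, B = z - ((c₁ : ℚ) - c₂ + σ) / 2)
    (hadm : Admissible ((n + 1 : ℕ) : ℚ) A B (((c₁ : ℚ) - c₂) / 2)) :
    innerSum (n + 1) t a b u v = qpow (-(((c₁ : ℚ) - c₂) ^ 2 / (4 * ((n + 1 : ℕ) : ℚ)))) *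
      ∑ i ∈ Finset.Icc (Q - T) Q, qbin (A + B + Q - i) (Q - i) * ∑ m ∈ box n (2 * T),
        chain σ (2 * i + d) m 0 * (qbin (A + ext (2 * i + d) m 0 1 / 2) (i + c₁) *
          qbin (B + ext (2 * i + d) m 0 1 / 2) (i + c₂)) := by
  have e : ((Q + c₁ : ℤ) : ℚ) - (Q + c₂ : ℤ) = c₁ - c₂ := by push_cast; ring
  have ha' : a = ((Q + c₁ : ℤ) : ℚ) := by rw [ha]; push_cast; rfl
  have hb' : b = ((Q + c₂ : ℤ) : ℚ) := by rw [hb]; push_cast; rfl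
  subst hu hv hd
  rw [ha', hb'] at ht ⊢
  rw [Nat.cast_add, Nat.cast_one] at ht hadm ⊢
  rw [innerSum_eq_dual h1 h2 ht (by rw [e]; exact hA) (by rw [e]; exact hB)
    (by rw [e]; exact hadm), e]
  push_cast
  congr 1
  have hmap : Finset.Icc (Q - T) Q = (Finset.Icc 0 T).map (Equiv.subLeft Q).toEmbedding := by
    ext i
    simp only [Finset.mem_Icc, Finset.mem_map, Equiv.coe_toEmbedding, Equiv.subLeft_apply]
    constructor
    · rintro ⟨h1, h2⟩
      exact ⟨Q - i, ⟨by omega, by omega⟩, by omega⟩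
    · rintro ⟨j, ⟨h1, h2⟩, rfl⟩
      omega
  rw [hmap, Finset.sum_map]
  refine Finset.sum_congr rfl fun j _ => ?_
  simp only [Equiv.coe_toEmbedding, Equiv.subLeft_apply]
  have e1 : Q + c₁ + (Q + c₂) - 2 * j = 2 * (Q - j) + (c₁ + c₂) := by ring
  have e2 : A + B + Q - ((Q - j : ℤ) : ℚ) = A + B + j := by push_cast; ring
  have e3 : (Q : ℚ) - ((Q - j : ℤ) : ℚ) = j := by push_cast; ring
  have e4 : (Q : ℚ) + c₁ - j = ((Q - j : ℤ) : ℚ) + c₁ := by push_cast; ring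
  have e5 : (Q : ℚ) + c₂ - j = ((Q - j : ℤ) : ℚ) + c₂ := by push_cast; ring
  rw [e1, e2, e3, e4, e5]

/-! ### Summands of both polynomials and finiteness of the sums -/

/-- Reflecting each q-binomial frees the top entries of i and gives the lower entries the form i +
c₁, i + c₂ with c₁ + c₂ = d, as in `innerSum_eq_dual_shift`. -/
lemma XTerm_eq (p p' r s d L₁ L₂ i e : ℚ) (j : ℤ) :
    XTerm p p' r s (L₁ - i + e / 2) (i + d) (L₂ - d - i + e / 2) i j =
      qpow (j * (p * p' * j + p' * (L₁ - L₂ + d + r) - p * s)) *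
        (qbin (L₁ + d - (p' - p) * j + e / 2) (i + (d - p' * j)) *
          qbin (L₂ - d + (p' - p) * j + e / 2) (i + p' * j)) -
      qpow ((p * j + (L₁ - L₂ + d) + r) * (p' * j + s)) *
        (qbin (L₂ - d + (p' - p) * j - r + s + e / 2) (i + (p' * j + s)) *
          qbin (L₁ + d - (p' - p) * j + r - s + e / 2) (i + (d - p' * j - s))) := by
  have h1 : ∀ x y x' y' : ℚ, x = x' → x - y = y' → qbin x y = qbin x' y' := by
    rintro x y _ _ rfl rfl
    exact qbin_symm x y
  rw [XTerm, show L₁ - i + e / 2 - (L₂ - d - i + e / 2) = L₁ - L₂ + d by ring,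
    h1 (L₁ - i + e / 2 + (i + d) - (p' - p) * j) (L₁ - i + e / 2 + p * j)
      (L₁ + d - (p' - p) * j + e / 2) (i + (d - p' * j)) (by ring) (by ring),
    h1 (L₂ - d - i + e / 2 + i + (p' - p) * j) (L₂ - d - i + e / 2 - p * j)
      (L₂ - d + (p' - p) * j + e / 2) (i + p' * j) (by ring) (by ring),
    h1 (L₁ - i + e / 2 + (i + d) - (p' - p) * j + r - s) (L₁ - i + e / 2 + p * j + r)
      (L₁ + d - (p' - p) * j + r - s + e / 2) (i + (d - p' * j - s)) (by ring) (by ring),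
    h1 (L₂ - d - i + e / 2 + i + (p' - p) * j - r + s) (L₂ - d - i + e / 2 - p * j - r)
      (L₂ - d + (p' - p) * j - r + s + e / 2) (i + (p' * j + s)) (by ring) (by ring)]
  ring

lemma XTerm_ne_zero {p p' r s d L₁ L₂ i e : ℚ} {j : ℤ}
    (h : XTerm p p' r s (L₁ - i + e / 2) (i + d) (L₂ - d - i + e / 2) i j ≠ 0) :
    (p' * j ≤ i + d ∧ -i ≤ p' * j) ∨ (p' * j + s ≤ i + d ∧ -i ≤ p' * j + s) := by
  rw [XTerm_eq] at h
  by_contra hc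
  rw [not_or, not_and_or, not_and_or] at hc
  apply h
  have h1 : ∀ x y z w : ℚ, z < 0 ∨ w < 0 → qbin x z * qbin y w = 0 := by
    rintro x y z w (h | h)
    · rw [qbin_eq_zero (Or.inl h), zero_mul]
    · rw [qbin_eq_zero (b := w) (Or.inl h), mul_zero]
  rw [h1, h1, mul_zero, mul_zero, sub_zero]
  · rcases hc.2 with h | h
    · exact Or.inr (by linarith)
    · exact Or.inl (by linarith)
  · rcases hc.1 with h | h
    · exact Or.inl (by linarith)
    · exact Or.inr (by linarith)

section transform
variable {n σ : ℕ} {p p' r s M₁ M₂ : ℤ} {L₁ L₂ : ℚ} (hp' : 1 ≤ p')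
include hp'

/-- The two lower entries of either product are nonnegative with sum 2i + M₁₂. This bounds p'j,
hence j, as p' ≥ 1. -/
lemma XTerm_support {i : ℤ} {e : ℚ} {j : ℤ} (h : XTerm p p' r s (L₁ - i + e / 2)
      (i + ((M₁ : ℚ) - M₂)) (L₂ - ((M₁ : ℚ) - M₂) - i + e / 2) i j ≠ 0) :
    0 ≤ 2 * i + (M₁ - M₂) ∧
      -(|i| + |M₁| + |M₂| + |s|) ≤ j ∧ j ≤ |i| + |M₁| + |M₂| + |s| := by
  have key := XTerm_ne_zero h
  have key' : (p' * j ≤ i + (M₁ - M₂) ∧ -i ≤ p' * j) ∨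
      (p' * j + s ≤ i + (M₁ - M₂) ∧ -i ≤ p' * j + s) := by exact_mod_cast key
  refine ⟨by omega, ?_⟩
  have a1 := le_abs_self i
  have a2 := neg_abs_le i
  have a3 := le_abs_self M₁
  have a4 := neg_abs_le M₁
  have a5 := le_abs_self M₂
  have a6 := neg_abs_le M₂
  have a7 := le_abs_self s
  have a8 := neg_abs_le s
  apply bounds_of_mul_bounds hp' <;> generalize p' * j = x at * <;> omega

lemma finite_support_XTerm (i : ℤ) (e : ℚ) : (Function.support (XTerm p p' r s (L₁ - i + e / 2)
      (i + ((M₁ : ℚ) - M₂)) (L₂ - ((M₁ : ℚ) - M₂) - i + e / 2) i)).Finite :=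
  (Set.finite_Icc (-(|i| + |M₁| + |M₂| + |s|)) (|i| + |M₁| + |M₂| + |s|)).subset
    fun _ hj => (XTerm_support hp' hj).2

lemma X_eq_zero {i : ℤ} (hi : 2 * i + (M₁ - M₂) < 0) (e : ℚ) : X p p' r s (L₁ - i + e / 2)
      (i + ((M₁ : ℚ) - M₂)) (L₂ - ((M₁ : ℚ) - M₂) - i + e / 2) i = 0 := by
  rw [X, finsum_eq_zero_of_forall_eq_zero]
  intro j
  by_contra h
  exact absurd (XTerm_support hp' h).1 (not_le.2 hi)

lemma dualInner_eq_zero {i : ℤ} (hi : 2 * i + (M₁ - M₂) < 0) :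
    dualInner (n + 1) σ p p' r s ((M₁ : ℚ) - M₂) L₁ L₂ i = 0 := by
  rw [dualInner, finsum_mem_eq_zero_of_forall_eq_zero]
  intro x _
  rw [dualInnerTerm, X_eq_zero hp' hi, mul_zero]

lemma dualTerm_support {i : ℤ}
    (h : dualTerm (n + 1) σ p p' r s M₁ L₁ M₂ L₂ i ≠ 0) :
    i ≤ M₂ ∧ 0 ≤ 2 * i + (M₁ - M₂) := by
  constructor
  · have := (qbin_ne_zero (right_ne_zero_of_mul (left_ne_zero_of_mul h))).1
    have : (i : ℚ) ≤ M₂ := by linarith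
    exact_mod_cast this
  · by_contra hi
    exact right_ne_zero_of_mul h (dualInner_eq_zero hp' (not_le.1 hi))

lemma dualFinite : DualFinite (n + 1) σ p p' r s M₁ L₁ M₂ L₂ := by
  refine ⟨(Set.finite_Icc (-(|M₁| + |M₂|)) M₂).subset fun i hi => ?_, fun i => ⟨?_, ?_⟩⟩
  · obtain ⟨h1, h2⟩ := dualTerm_support hp' hi
    have a3 := le_abs_self M₁
    have a6 := neg_abs_le M₂
    have a7 := abs_nonneg M₁
    have a8 := abs_nonneg M₂
    exact ⟨by omega, h1⟩
  · have := finite_mnPairs_inter_support (n := n) (σ := σ) (a := 2 * i + (M₁ - M₂)) (b := 0)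
      (t := (2 * i + ((M₁ : ℚ) - M₂) + σ * ((n + 1 : ℕ) : ℚ)) / (2 * ((n + 1 : ℕ) : ℚ)))
      (by push_cast; ring)
    push_cast at this ⊢
    exact this.subset (Set.inter_subset_inter_right _ fun x hx => left_ne_zero_of_mul hx)
  · intro x _
    exact finite_support_XTerm hp' i _

omit hp' in
lemma XNTerm_ne_zero {N : ℕ} {P P' R S j : ℚ} {z : ℤ} (hz : j = z)
    (h : XNTerm N σ P P' R S M₁ L₁ M₂ L₂ z ≠ 0) :
    (0 ≤ M₁ + P * j ∧ 0 ≤ M₂ - P * j) ∨ (0 ≤ M₁ + P * j + R ∧ 0 ≤ M₂ - P * j - R) := by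
  subst hz
  by_contra hc
  rw [not_or, not_and_or, not_and_or, not_le, not_le, not_le, not_le] at hc
  apply h
  rw [XNTerm, innerSum_eq_zero hc.1, innerSum_eq_zero hc.2, mul_zero, mul_zero, sub_zero]

lemma XNTerm_support {N : ℕ} {P' S : ℚ} {j : ℤ}
    (h : XNTerm N σ p' P' (s - ((M₁ : ℚ) - M₂)) S M₁ L₁ M₂ L₂ j ≠ 0) :
    -(|M₁| + |M₂| + |s|) ≤ j ∧ j ≤ |M₁| + |M₂| + |s| := by
  have key := XNTerm_ne_zero rfl h
  have key' : (0 ≤ M₁ + p' * j ∧ 0 ≤ M₂ - p' * j) ∨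
      (0 ≤ M₁ + p' * j + (s - (M₁ - M₂)) ∧ 0 ≤ M₂ - p' * j - (s - (M₁ - M₂))) := by
    exact_mod_cast key
  have a3 := le_abs_self M₁
  have a4 := neg_abs_le M₁
  have a5 := le_abs_self M₂
  have a6 := neg_abs_le M₂
  have a7 := le_abs_self s
  have a8 := neg_abs_le s
  apply bounds_of_mul_bounds hp' <;> generalize p' * j = x at * <;> omega

lemma xnFinite (P' S : ℚ) :
    XNFinite (n + 1) σ p' P' (s - ((M₁ : ℚ) - M₂)) S M₁ L₁ M₂ L₂ := by
  refine ⟨(Set.finite_Icc (-(|M₁| + |M₂| + |s|)) (|M₁| + |M₂| + |s|)).subset fun j hj =>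
    XNTerm_support hp' hj, fun j => ⟨?_, ?_⟩⟩
  · exact finite_innerTerm _ _ ⟨M₁ + p' * j, by push_cast; ring⟩
      ⟨M₂ - p' * j, by push_cast; ring⟩ (by ring)
  · exact finite_innerTerm _ _ ⟨M₁ + p' * j + (s - (M₁ - M₂)), by push_cast; ring⟩
      ⟨M₂ - p' * j - (s - (M₁ - M₂)), by push_cast; ring⟩ (by ring)

end transform

/-! ### Interchange of summations: the dual Burge transform -/

/-- Needed because the first part of the level-N summand at -j corresponds to the first part of
Burge's summand at j. -/
lemma sum_Icc_neg (J : ℤ) (f : ℤ → QSeries) :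
    ∑ j ∈ Finset.Icc (-J) J, f j = ∑ j ∈ Finset.Icc (-J) J, f (-j) := by
  refine Finset.sum_equiv (Equiv.neg ℤ) (fun j => ?_) fun j _ => ?_
  · simp only [Finset.mem_Icc, Equiv.neg_apply]
    omega
  · simp

/-- The product of Gaussian polynomials in the first part of the summand of Burge's polynomial. -/
noncomputable def burgeFst (p p' d L₁ L₂ i : ℚ) (j : ℤ) (e : ℚ) : QSeries :=
  qbin (L₁ + d - (p' - p) * j + e / 2) (i + (d - p' * j)) *
    qbin (L₂ - d + (p' - p) * j + e / 2) (i + p' * j)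

/-- The product of Gaussian polynomials in the second part of the summand of Burge's
polynomial. -/
noncomputable def burgeSnd (p p' r s d L₁ L₂ i : ℚ) (j : ℤ) (e : ℚ) : QSeries :=
  qbin (L₂ - d + (p' - p) * j - r + s + e / 2) (i + (p' * j + s)) *
    qbin (L₁ + d - (p' - p) * j + r - s + e / 2) (i + (d - p' * j - s))

lemma qbin_mul_qbin_eq_zero {x y a b : ℚ} (h : a + b < 0) : qbin x a * qbin y b = 0 := by
  rcases lt_or_ge a 0 with ha | ha
  · rw [qbin_eq_zero (Or.inl ha), zero_mul]
  · rw [qbin_eq_zero (b := b) (Or.inl (by linarith)), mul_zero]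

section transform
variable {n σ : ℕ} {p p' r s M₁ M₂ : ℤ} {L₁ L₂ : ℚ}

/-- The summand of the dual transform, with the sums over `j` written outside. -/
lemma dualTerm_eq (hp' : 1 ≤ p') {i J T : ℤ} (hi : i ≤ M₂)
    (hJ : 4 * (|M₁| + |M₂| + |s|) ≤ J) (hT : |M₁| + |M₂| ≤ T) :
    dualTerm (n + 1) σ p p' r s M₁ L₁ M₂ L₂ i =
      qpow (-(((M₁ : ℚ) - M₂) ^ 2 / (4 * ((n + 1 : ℕ) : ℚ)))) * ∑ j ∈ Finset.Icc (-J) J,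
        (qpow (j * (p * p' * j + p' * (L₁ - L₂ + (M₁ - M₂) + r) - p * s)) *
          (qbin (L₁ + L₂ + M₂ - i) (M₂ - i) * ∑ m ∈ box n (2 * T),
            chain σ (2 * i + (M₁ - M₂)) m 0 *
            burgeFst p p' (M₁ - M₂) L₁ L₂ i j (ext (2 * i + (M₁ - M₂)) m 0 1)) -
        qpow ((p * j + (L₁ - L₂ + (M₁ - M₂)) + r) * (p' * j + s)) *
          (qbin (L₁ + L₂ + M₂ - i) (M₂ - i) * ∑ m ∈ box n (2 * T),
            chain σ (2 * i + (M₁ - M₂)) m 0 *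
            burgeSnd p p' r s (M₁ - M₂) L₁ L₂ i j (ext (2 * i + (M₁ - M₂)) m 0 1))) := by
  have a2 := neg_abs_le M₁
  have a3 := le_abs_self M₁
  have a4 := neg_abs_le M₂
  have a5 := le_abs_self M₂
  have a6 := abs_nonneg s
  rw [dualTerm]
  by_cases hneg : 2 * i + (M₁ - M₂) < 0
  · rw [dualInner_eq_zero hp' hneg, mul_zero, Finset.sum_eq_zero, mul_zero]
    intro j _
    have hneg' : 2 * (i : ℚ) + (M₁ - M₂) < 0 := by exact_mod_cast hneg
    rw [Finset.sum_eq_zero, Finset.sum_eq_zero]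
    · ring
    · intro m _
      rw [burgeSnd, qbin_mul_qbin_eq_zero (by linarith), mul_zero]
    · intro m _
      rw [burgeFst, qbin_mul_qbin_eq_zero (by linarith), mul_zero]
  rw [not_lt] at hneg
  have hinner : dualInner (n + 1) σ p p' r s ((M₁ : ℚ) - M₂) L₁ L₂ i =
      qpow (-((2 * (i : ℚ) + (M₁ - M₂)) ^ 2 / (4 * ((n + 1 : ℕ) : ℚ)))) * ∑ m ∈ box n (2 * T),
        chain σ (2 * i + (M₁ - M₂)) m 0 * X p p' r s
          (L₁ - i + ext (2 * i + (M₁ - M₂)) m 0 1 / 2) (i + ((M₁ : ℚ) - M₂))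
          (L₂ - ((M₁ : ℚ) - M₂) - i + ext (2 * i + (M₁ - M₂)) m 0 1 / 2) i := by
    have := finsum_mnPairs (n := n) (σ := σ) (a := 2 * i + (M₁ - M₂)) (b := 0)
      (t := (2 * i + ((M₁ : ℚ) - M₂) + σ * ((n + 1 : ℕ) : ℚ)) / (2 * ((n + 1 : ℕ) : ℚ)))
      (by push_cast; ring) hneg le_rfl (T := 2 * T) (by omega) (by omega)
      (fun m => X p p' r s
          (L₁ - i + ext (2 * i + (M₁ - M₂)) m 0 1 / 2) (i + ((M₁ : ℚ) - M₂))
          (L₂ - ((M₁ : ℚ) - M₂) - i + ext (2 * i + (M₁ - M₂)) m 0 1 / 2) i)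
    push_cast at this ⊢
    rw [sub_zero] at this
    rw [← this, dualInner]
    push_cast
    refine finsum_mem_congr rfl fun x _ => ?_
    rw [dualInnerTerm, firstComp_toRat (n := n) (2 * i + (M₁ - M₂)) 0 x.1 0 (by norm_num)]
  have hX : ∀ e : ℚ, X p p' r s (L₁ - i + e / 2) (i + ((M₁ : ℚ) - M₂))
      (L₂ - ((M₁ : ℚ) - M₂) - i + e / 2) i = ∑ j ∈ Finset.Icc (-J) J,
      (qpow (j * (p * p' * j + p' * (L₁ - L₂ + (M₁ - M₂) + r) - p * s)) *
        burgeFst p p' (M₁ - M₂) L₁ L₂ i j e -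
      qpow ((p * j + (L₁ - L₂ + (M₁ - M₂)) + r) * (p' * j + s)) *
        burgeSnd p p' r s (M₁ - M₂) L₁ L₂ i j e) := by
    intro e
    rw [X, finsum_eq_sum_of_support_subset (s := Finset.Icc (-J) J)]
    · exact Finset.sum_congr rfl fun j _ => XTerm_eq _ _ _ _ _ _ _ _ _ j
    · intro j hj
      obtain ⟨h1, h2, h3⟩ := XTerm_support hp' hj
      have : |i| ≤ |M₁| + |M₂| := abs_le.2 ⟨by omega, by omega⟩
      rw [Finset.coe_Icc]
      exact ⟨by omega, by omega⟩
  -- The prefactor q^{i(i+M₁₂)/N} cancels the i-dependence of the chord factor q^{-(2i+M₁₂)²/(4N)}.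
  have hpow : qpow ((i : ℚ) * (i + (M₁ - M₂)) / ((n + 1 : ℕ) : ℚ)) *
      qpow (-((2 * (i : ℚ) + (M₁ - M₂)) ^ 2 / (4 * ((n + 1 : ℕ) : ℚ))))
      = qpow (-(((M₁ : ℚ) - M₂) ^ 2 / (4 * ((n + 1 : ℕ) : ℚ)))) := by
    rw [← qpow_add]
    congr 1
    have : ((n + 1 : ℕ) : ℚ) ≠ 0 := by positivity
    field_simp
    ring
  have hsum : ∑ m ∈ box n (2 * T), chain σ (2 * i + (M₁ - M₂)) m 0 * X p p' r s
          (L₁ - i + ext (2 * i + (M₁ - M₂)) m 0 1 / 2) (i + ((M₁ : ℚ) - M₂))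
          (L₂ - ((M₁ : ℚ) - M₂) - i + ext (2 * i + (M₁ - M₂)) m 0 1 / 2) i =
      ∑ j ∈ Finset.Icc (-J) J,
        (qpow (j * (p * p' * j + p' * (L₁ - L₂ + (M₁ - M₂) + r) - p * s)) *
          (∑ m ∈ box n (2 * T), chain σ (2 * i + (M₁ - M₂)) m 0 *
            burgeFst p p' (M₁ - M₂) L₁ L₂ i j (ext (2 * i + (M₁ - M₂)) m 0 1)) -
        qpow ((p * j + (L₁ - L₂ + (M₁ - M₂)) + r) * (p' * j + s)) *
          (∑ m ∈ box n (2 * T), chain σ (2 * i + (M₁ - M₂)) m 0 *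
            burgeSnd p p' r s (M₁ - M₂) L₁ L₂ i j (ext (2 * i + (M₁ - M₂)) m 0 1))) := by
    simp only [hX, Finset.mul_sum]
    rw [Finset.sum_comm]
    refine Finset.sum_congr rfl fun j _ => ?_
    rw [← Finset.sum_sub_distrib]
    refine Finset.sum_congr rfl fun m _ => ?_
    ring
  rw [hinner, hsum, ← hpow, mul_assoc, mul_assoc]
  congr 1
  rw [mul_left_comm]
  congr 1
  rw [Finset.mul_sum]
  refine Finset.sum_congr rfl fun j _ => ?_
  ring

/-- The dual Burge transform, under the conditions that make the generalized `q`-Saalschütz sum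
applicable to each term. -/
theorem XN_eq_finsum_dualTerm (hp' : 1 ≤ p')
    (hL₁ : ∃ z : ℤ, L₁ + ((M₁ : ℚ) - M₂ + σ) / 2 = z)
    (hL₂ : ∃ z : ℤ, L₂ + ((M₁ : ℚ) - M₂ + σ) / 2 = z)
    (h₁ : ∀ j : ℤ, Admissible ((n + 1 : ℕ) : ℚ) (L₁ + (M₁ - M₂) - (p' - p) * j)
      (L₂ - (M₁ - M₂) + (p' - p) * j) (((M₁ : ℚ) - M₂) / 2 - p' * j))
    (h₂ : ∀ j : ℤ, Admissible ((n + 1 : ℕ) : ℚ) (L₁ + (M₁ - M₂) - (p' - p) * j + r - s)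
      (L₂ - (M₁ - M₂) + (p' - p) * j - r + s) (((M₁ : ℚ) - M₂) / 2 - p' * j - s)) :
    XN (n + 1) σ p' (((n + 1 : ℕ) : ℚ) * p + p') (s - (M₁ - M₂))
      (((n + 1 : ℕ) : ℚ) * (r + (L₁ - L₂) + (M₁ - M₂)) + s - (M₁ - M₂)) M₁ L₁ M₂ L₂
      = ∑ᶠ i : ℤ, dualTerm (n + 1) σ p p' r s M₁ L₁ M₂ L₂ i := by
  have hN : ((n + 1 : ℕ) : ℚ) ≠ 0 := by positivity
  obtain ⟨z₁, hz₁⟩ := hL₁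
  obtain ⟨z₂, hz₂⟩ := hL₂
  -- J bounds every j with a nonzero summand on either side; T bounds the chain ends M₂ + c₁ and M₂
  -- + c₂ that occur for |j| ≤ J.
  obtain ⟨J, hJ⟩ : ∃ J, J = 4 * (|M₁| + |M₂| + |s|) := ⟨_, rfl⟩
  obtain ⟨T, hT⟩ : ∃ T, T = |M₁| + |M₂| + |s| + p' * J := ⟨_, rfl⟩
  have a2 := neg_abs_le M₁
  have a3 := le_abs_self M₁
  have a4 := neg_abs_le M₂
  have a5 := le_abs_self M₂
  have a6 := neg_abs_le s
  have a7 := le_abs_self s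
  have hJ0 : 0 ≤ J := by omega
  have hpJ : 0 ≤ p' * J := by positivity
  have hbd : ∀ j ∈ Finset.Icc (-J) J, -(p' * J) ≤ p' * j ∧ p' * j ≤ p' * J := by
    intro j hj
    rw [Finset.mem_Icc] at hj
    constructor <;> nlinarith
  let V (f : ℤ → ℤ → ℚ → QSeries) (j : ℤ) : QSeries := ∑ i ∈ Finset.Icc (M₂ - T) M₂,
    qbin (L₁ + L₂ + M₂ - i) (M₂ - i) * ∑ m ∈ box n (2 * T),
      chain σ (2 * i + (M₁ - M₂)) m 0 * f i j (ext (2 * i + (M₁ - M₂)) m 0 1)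
  -- the two inner sums
  have hfst : ∀ j ∈ Finset.Icc (-J) J,
      innerSum (n + 1) (((M₁ : ℚ) - M₂ + 2 * p' * (-j : ℤ) + σ * (n + 1 : ℕ)) / (2 * (n + 1 : ℕ)))
        (M₁ + p' * (-j : ℤ)) (M₂ - p' * (-j : ℤ))
        (M₁ + L₁ - (((n + 1 : ℕ) : ℚ) * p + p' - p') * (-j : ℤ) / (n + 1 : ℕ))
        (M₂ + L₂ + (((n + 1 : ℕ) : ℚ) * p + p' - p') * (-j : ℤ) / (n + 1 : ℕ)) =
      qpow (-(((M₁ : ℚ) - M₂ - 2 * p' * j) ^ 2 / (4 * ((n + 1 : ℕ) : ℚ)))) *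
        V (fun i j e => burgeFst p p' (M₁ - M₂) L₁ L₂ i j e) j := by
    intro j hj
    obtain ⟨b1, b2⟩ := hbd j hj
    have := innerSum_eq_dual_shift (n := n) (σ := σ) (Q := M₂) (c₁ := M₁ - M₂ - p' * j)
      (c₂ := p' * j) (d := M₁ - M₂) (T := T) (a := M₁ + p' * (-j : ℤ)) (b := M₂ - p' * (-j : ℤ))
      (u := M₁ + L₁ - (((n + 1 : ℕ) : ℚ) * p + p' - p') * (-j : ℤ) / (n + 1 : ℕ))
      (v := M₂ + L₂ + (((n + 1 : ℕ) : ℚ) * p + p' - p') * (-j : ℤ) / (n + 1 : ℕ))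
      (A := L₁ + (M₁ - M₂) - (p' - p) * j) (B := L₂ - (M₁ - M₂) + (p' - p) * j)
      (t := ((M₁ : ℚ) - M₂ + 2 * p' * (-j : ℤ) + σ * (n + 1 : ℕ)) / (2 * (n + 1 : ℕ)))
      (by ring) (by push_cast; ring) (by push_cast; ring)
      (by rw [Int.cast_neg]; field_simp; ring) (by rw [Int.cast_neg]; field_simp; ring)
      (by push_cast; ring) (by omega) (by omega)
      ⟨z₁ + p * j, by push_cast; rw [← hz₁]; ring⟩
      ⟨z₂ - (M₁ - M₂) - p * j, by push_cast; rw [← hz₂]; ring⟩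
      (by
        have := h₁ j
        have e : (((M₁ - M₂ - p' * j : ℤ) : ℚ) - (p' * j : ℤ)) / 2
          = ((M₁ : ℚ) - M₂) / 2 - p' * j := by push_cast; ring
        rwa [e])
    rw [this]
    congr 1
    · congr 4
      push_cast
      ring
    · refine Finset.sum_congr rfl fun i _ => ?_
      have e : L₁ + ((M₁ : ℚ) - M₂) - (p' - p) * j + (L₂ - (M₁ - M₂) + (p' - p) * j) + M₂ - i
        = L₁ + L₂ + M₂ - i := by ring
      rw [e]
      simp only [burgeFst]
      push_cast
      rfl
  have hsnd : ∀ j ∈ Finset.Icc (-J) J,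
      innerSum (n + 1) (((M₁ : ℚ) - M₂ + 2 * p' * j + 2 * (s - (M₁ - M₂)) + σ * (n + 1 : ℕ)) /
          (2 * (n + 1 : ℕ))) (M₁ + p' * j + (s - (M₁ - M₂))) (M₂ - p' * j - (s - (M₁ - M₂)))
        (M₁ + L₁ - ((((n + 1 : ℕ) : ℚ) * p + p' - p') * j - (s - (M₁ - M₂)) +
          (((n + 1 : ℕ) : ℚ) * (r + (L₁ - L₂) + (M₁ - M₂)) + s - (M₁ - M₂))) / (n + 1 : ℕ))
        (M₂ + L₂ + ((((n + 1 : ℕ) : ℚ) * p + p' - p') * j - (s - (M₁ - M₂)) +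
          (((n + 1 : ℕ) : ℚ) * (r + (L₁ - L₂) + (M₁ - M₂)) + s - (M₁ - M₂))) / (n + 1 : ℕ)) =
      qpow (-(((M₁ : ℚ) - M₂ - 2 * p' * j - 2 * s) ^ 2 / (4 * ((n + 1 : ℕ) : ℚ)))) *
        V (fun i j e => burgeSnd p p' r s (M₁ - M₂) L₁ L₂ i j e) j := by
    intro j hj
    obtain ⟨b1, b2⟩ := hbd j hj
    -- Compared with the first product the roles of A and B are exchanged, so admissibility enters
    -- through `Admissible.symm`.
    have := innerSum_eq_dual_shift (n := n) (σ := σ) (Q := M₂) (c₁ := p' * j + s)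
      (c₂ := M₁ - M₂ - p' * j - s) (d := M₁ - M₂) (T := T)
      (a := M₁ + p' * j + (s - (M₁ - M₂))) (b := M₂ - p' * j - (s - (M₁ - M₂)))
      (u := M₁ + L₁ - ((((n + 1 : ℕ) : ℚ) * p + p' - p') * j - (s - (M₁ - M₂)) +
          (((n + 1 : ℕ) : ℚ) * (r + (L₁ - L₂) + (M₁ - M₂)) + s - (M₁ - M₂))) / (n + 1 : ℕ))
      (v := M₂ + L₂ + ((((n + 1 : ℕ) : ℚ) * p + p' - p') * j - (s - (M₁ - M₂)) +
          (((n + 1 : ℕ) : ℚ) * (r + (L₁ - L₂) + (M₁ - M₂)) + s - (M₁ - M₂))) / (n + 1 : ℕ))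
      (A := L₂ - (M₁ - M₂) + (p' - p) * j - r + s) (B := L₁ + (M₁ - M₂) - (p' - p) * j + r - s)
      (t := ((M₁ : ℚ) - M₂ + 2 * p' * j + 2 * (s - (M₁ - M₂)) + σ * (n + 1 : ℕ)) /
          (2 * (n + 1 : ℕ)))
      (by ring) (by push_cast; ring) (by push_cast; ring)
      (by field_simp; ring) (by field_simp; ring) (by push_cast; ring) (by omega) (by omega)
      ⟨z₂ - (M₁ - M₂) - p * j - r, by push_cast; rw [← hz₂]; ring⟩
      ⟨z₁ + p * j + r, by push_cast; rw [← hz₁]; ring⟩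
      (by
        have := (h₂ j).symm
        have e : (((p' * j + s : ℤ) : ℚ) - (M₁ - M₂ - p' * j - s : ℤ)) / 2
          = -(((M₁ : ℚ) - M₂) / 2 - p' * j - s) := by push_cast; ring
        rwa [e])
    rw [this]
    congr 1
    · congr 2
      push_cast
      ring
    · refine Finset.sum_congr rfl fun i _ => ?_
      have e : L₂ - ((M₁ : ℚ) - M₂) + (p' - p) * j - r + s +
        (L₁ + (M₁ - M₂) - (p' - p) * j + r - s) + M₂ - i = L₁ + L₂ + M₂ - i := by ring
      rw [e]
      simp only [burgeSnd]
      push_cast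
      rfl
  -- the right-hand side as a finite sum
  have hrhs : ∑ᶠ i : ℤ, dualTerm (n + 1) σ p p' r s M₁ L₁ M₂ L₂ i =
      qpow (-(((M₁ : ℚ) - M₂) ^ 2 / (4 * ((n + 1 : ℕ) : ℚ)))) * ∑ j ∈ Finset.Icc (-J) J,
        (qpow (j * (p * p' * j + p' * (L₁ - L₂ + (M₁ - M₂) + r) - p * s)) *
          V (fun i j e => burgeFst p p' (M₁ - M₂) L₁ L₂ i j e) j -
        qpow ((p * j + (L₁ - L₂ + (M₁ - M₂)) + r) * (p' * j + s)) *
          V (fun i j e => burgeSnd p p' r s (M₁ - M₂) L₁ L₂ i j e) j) := by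
    rw [finsum_eq_sum_of_support_subset (s := Finset.Icc (M₂ - T) M₂)]
    · rw [Finset.sum_congr rfl fun i hi => dualTerm_eq hp' (Finset.mem_Icc.1 hi).2 hJ.ge
        (show |M₁| + |M₂| ≤ T by omega), ← Finset.mul_sum, Finset.sum_comm]
      congr 1
      refine Finset.sum_congr rfl fun j _ => ?_
      rw [Finset.sum_sub_distrib, ← Finset.mul_sum, ← Finset.mul_sum]
    · intro i hi
      obtain ⟨g1, g2⟩ := dualTerm_support hp' hi
      rw [Finset.coe_Icc]
      exact ⟨by omega, g1⟩
  rw [hrhs, XN, finsum_eq_sum_of_support_subset (s := Finset.Icc (-J) J)]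
  swap
  · intro j hj
    obtain ⟨g1, g2⟩ := XNTerm_support hp' hj
    rw [Finset.coe_Icc]
    exact ⟨by omega, by omega⟩
  simp only [XNTerm]
  -- What remains is a comparison of exponents: the level-N exponent minus the chord term (c₁ -
  -- c₂)²/(4N) is Burge's exponent minus M₁₂²/(4N).
  rw [Finset.sum_sub_distrib, Finset.sum_sub_distrib, sum_Icc_neg]
  refine Eq.trans (congrArg₂ (· - ·) ?_ ?_) (mul_sub _ _ _).symm <;> rw [Finset.mul_sum]
  · refine Finset.sum_congr rfl fun j hj => ?_
    rw [hfst j hj, ← mul_assoc, ← mul_assoc, ← qpow_add, ← qpow_add]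
    congr 2
    push_cast
    field_simp
    ring
  · refine Finset.sum_congr rfl fun j hj => ?_
    rw [hsnd j hj, ← mul_assoc, ← mul_assoc, ← qpow_add, ← qpow_add]
    congr 2
    push_cast
    field_simp
    ring

end transform

/-! ### Sufficient conditions for admissibility, and the theorem -/

/-- The premise on B bounds the integer j by the left quotient of the first floor inequality, hence
by the right one, which says A ≥ 0. In the same way the premise on A bounds -j and gives B ≥ 0. -/
lemma admissible_of_sufficient {N : ℕ} {p p' r s M₁ M₂ L₁ L₂ : ℚ} (hN : N ≠ 0) (hp : 0 < p)
    (hpp' : p < p') (h : Sufficient N p p' r s M₁ L₁ M₂ L₂) (j : ℤ) :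
    Admissible N (L₁ + (M₁ - M₂) - (p' - p) * j + r - s)
      (L₂ - (M₁ - M₂) + (p' - p) * j - r + s) ((M₁ - M₂) / 2 - p' * j - s) := by
  obtain ⟨h₁, h₂⟩ := h
  have hN' : (N : ℚ) ≠ 0 := by exact_mod_cast hN
  have hd : 0 < p' - p := by linarith
  have hq : 0 < p + p' / N := by
    have : 0 ≤ p' / N := div_nonneg (by linarith) N.cast_nonneg
    linarith
  intro hA hB
  have e₁ : L₂ - (M₁ - M₂) * (N - 1) / (2 * N) - r - s / N - j * (p + p' / N) =
      (L₂ - (M₁ - M₂) + (p' - p) * j - r + s) +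
        ((M₁ - M₂) / 2 - p' * j - s) * (1 + 1 / N) := by
    field_simp
    ring
  have e₂ : L₁ + (M₁ - M₂) * (N - 1) / (2 * N) + r + s / N - (-j : ℤ) * (p + p' / N) =
      (L₁ + (M₁ - M₂) - (p' - p) * j + r - s) -
        ((M₁ - M₂) / 2 - p' * j - s) * (1 + 1 / N) := by
    push_cast
    field_simp
    ring
  have g₁ : (j : ℚ) ≤ (L₁ + (M₁ - M₂) + r - s) / (p' - p) :=
    Int.le_floor.1 ((Int.le_floor.2 ((le_div_iff₀ hq).2 (by linarith))).trans h₁)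
  have g₂ : ((-j : ℤ) : ℚ) ≤ (L₂ - (M₁ - M₂) - r + s) / (p' - p) :=
    Int.le_floor.1 ((Int.le_floor.2 ((le_div_iff₀ hq).2 (by linarith))).trans h₂)
  rw [le_div_iff₀ hd] at g₁ g₂
  push_cast at g₂
  exact ⟨fun _ => Or.inl (by linarith), fun _ => Or.inl (by linarith)⟩

/-- In the symmetric case the generalized `q`-Saalschütz sum applies to each term. -/
lemma admissible_symmetric {p p' r s : ℤ} (N L : ℚ) (hr : 0 ≤ r) (hrp : r ≤ p) (hs : 0 ≤ s)
    (hsp' : s ≤ p') (j : ℤ) :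
    Admissible N (L - (p' - p) * j + r - s) (L + (p' - p) * j - r + s) (-(p' * j) - s) := by
  intro _ _
  -- The ranges of r and s give p'j + s and pj + r the same sign, nonnegative for j ≥ 0 and
  -- nonpositive for j < 0. The first determines the sign of l, and the second is the required
  -- comparison of B + l with A - l.
  rcases le_or_gt 0 j with hj | hj
  · have h1 : (0 : ℚ) ≤ p' * j + s := by
      have : 0 ≤ p' * j + s := by nlinarith
      exact_mod_cast this
    have h2 : (0 : ℚ) ≤ p * j + r := by
      have : 0 ≤ p * j + r := by nlinarith
      exact_mod_cast this
    exact ⟨fun _ => Or.inr (by linarith), fun h => by linarith⟩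
  · have h1 : (p' * j + s : ℚ) ≤ 0 := by
      have : p' * j + s ≤ 0 := by nlinarith
      exact_mod_cast this
    have h2 : (p * j + r : ℚ) ≤ 0 := by
      have : p * j + r ≤ 0 := by nlinarith
      exact_mod_cast this
    exact ⟨fun h => by linarith, fun _ => Or.inr (by linarith)⟩

end BurgeTransform

theorem mainTheorem3 :
    (∀ (N σ : ℕ) (p p' r s M₁ M₂ : ℤ) (L₁ L₂ : ℚ),
      1 ≤ N → (σ = 0 ∨ σ = 1) → 1 ≤ p → p < p' →
      Even (M₁ - M₂ + (σ : ℤ) * (N : ℤ)) →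
      (∃ z : ℤ, L₁ + ((M₁ : ℚ) - M₂ + σ) / 2 = z) →
      (∃ z : ℤ, L₂ + ((M₁ : ℚ) - M₂ + σ) / 2 = z) →
      BurgeTransform.Sufficient N p p' r s M₁ L₁ M₂ L₂ →
      BurgeTransform.Sufficient N p p' 0 0 M₁ L₁ M₂ L₂ →
      BurgeTransform.XNFinite N σ p' (N * p + p') (s - (M₁ - M₂))
          (N * (r + (L₁ - L₂) + (M₁ - M₂)) + s - (M₁ - M₂)) M₁ L₁ M₂ L₂ ∧
        BurgeTransform.DualFinite N σ p p' r s M₁ L₁ M₂ L₂ ∧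
        BurgeTransform.XN N σ p' (N * p + p') (s - (M₁ - M₂))
            (N * (r + (L₁ - L₂) + (M₁ - M₂)) + s - (M₁ - M₂)) M₁ L₁ M₂ L₂
          = ∑ᶠ i : ℤ,
              BurgeTransform.qpow ((i : ℚ) * (i + ((M₁ : ℚ) - M₂)) / N) *
                BurgeTransform.qbin (L₁ + L₂ + M₂ - i) (M₂ - i) *
                BurgeTransform.dualInner N σ p p' r s ((M₁ : ℚ) - M₂) L₁ L₂ i) ∧
    (∀ (N σ : ℕ) (p p' r s M : ℤ) (L : ℚ),
      1 ≤ N → (σ = 0 ∨ σ = 1) → 1 ≤ p → p < p' →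
      0 ≤ r → r ≤ p → 0 ≤ s → s ≤ p' →
      Even ((σ : ℤ) * (N : ℤ)) →
      (∃ z : ℤ, L + (σ : ℚ) / 2 = z) →
      ⌊(L + s + (r : ℚ) / N) / ((p' : ℚ) + (p : ℚ) / N)⌋ ≤ ⌊(L - r + s) / ((p' : ℚ) - p)⌋ →
      BurgeTransform.XNFinite N σ p' (N * p + p') s (N * r + s) M L M L ∧
        BurgeTransform.DualFinite N σ p p' r s M L M L ∧
        BurgeTransform.XN N σ p' (N * p + p') s (N * r + s) M L M L
          = ∑ i ∈ Finset.Icc (0 : ℤ) M,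
              BurgeTransform.qpow ((i : ℚ) ^ 2 / N) *
                BurgeTransform.qbin (2 * L + M - i) (2 * L) *
                BurgeTransform.dualInner N σ p p' r s 0 L L i) := by
  constructor
  · intro N σ p p' r s M₁ M₂ L₁ L₂ hN _ hp hpp' _ hL₁ hL₂ hrs h00
    obtain ⟨n, rfl⟩ : ∃ n, N = n + 1 := ⟨N - 1, by omega⟩
    have hp' : 1 ≤ p' := by omega
    have hp0 : (0 : ℚ) < p := by exact_mod_cast hp
    have hpq : (p : ℚ) < p' := by exact_mod_cast hpp'
    refine ⟨BurgeTransform.xnFinite hp' _ _, BurgeTransform.dualFinite hp',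
      BurgeTransform.XN_eq_finsum_dualTerm hp' hL₁ hL₂ (fun j => ?_) fun j =>
        BurgeTransform.admissible_of_sufficient n.succ_ne_zero hp0 hpq hrs j⟩
    -- The first product in each summand has the parameters of the second one at r = s = 0.
    simpa using BurgeTransform.admissible_of_sufficient n.succ_ne_zero hp0 hpq h00 j
  · intro N σ p p' r s M L hN _ hp hpp' hr hrp hs hsp' _ hL _
    obtain ⟨n, rfl⟩ : ∃ n, N = n + 1 := ⟨N - 1, by omega⟩
    have hp' : 1 ≤ p' := by omega
    have e₁ : (s : ℚ) - ((M : ℚ) - M) = s := by ring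
    have e₂ : ((n + 1 : ℕ) : ℚ) * (r + (L - L) + ((M : ℚ) - M)) + s - ((M : ℚ) - M)
        = ((n + 1 : ℕ) : ℚ) * r + s := by ring
    have hL' : ∃ z : ℤ, L + ((M : ℚ) - M + σ) / 2 = z := by simpa using hL
    have hfin := BurgeTransform.xnFinite (n := n) (σ := σ) (s := s) (M₁ := M) (M₂ := M)
      (L₁ := L) (L₂ := L) hp' (((n + 1 : ℕ) : ℚ) * p + p') (((n + 1 : ℕ) : ℚ) * r + s)
    have hmain := BurgeTransform.XN_eq_finsum_dualTerm (n := n) (σ := σ) (p := p) (r := r)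
      (s := s) (M₁ := M) (M₂ := M) hp' hL' hL'
      (fun j => by
        have := BurgeTransform.admissible_symmetric (p := p) (p' := p') (r := 0) (s := 0)
          ((n + 1 : ℕ) : ℚ) L le_rfl (by omega) le_rfl (by omega) j
        simpa using this)
      (fun j => by
        have := BurgeTransform.admissible_symmetric ((n + 1 : ℕ) : ℚ) L hr hrp hs hsp' j
        simpa using this)
    rw [e₁] at hfin
    rw [e₁, e₂] at hmain
    refine ⟨hfin, BurgeTransform.dualFinite hp', hmain.trans ?_⟩
    -- With M₁₂ = 0 the support condition 2i + M₁₂ ≥ 0 becomes i ≥ 0, and reflecting the q-binomial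
    -- turns its lower entry M - i into 2L.
    rw [finsum_eq_sum_of_support_subset (s := Finset.Icc (0 : ℤ) M)]
    · refine Finset.sum_congr rfl fun i _ => ?_
      rw [BurgeTransform.dualTerm, BurgeTransform.qbin_symm, sub_self,
        show L + L + (M : ℚ) - i - (M - i) = 2 * L by ring,
        show (i : ℚ) * (i + 0) = i ^ 2 by ring, two_mul]
    · intro i hi
      obtain ⟨h1, h2⟩ := BurgeTransform.dualTerm_support hp' hi
      rw [Finset.coe_Icc]
      exact ⟨by omega, h1⟩
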